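/- For every real number $C$ there is an $\varepsilon>0$ such that the following holds. Let $G$ be any simple graph on a finite vertex set $V$ with $|V|=n\ge 3$, and let $X_0,X_1,\dots$ be a simple random walk on $G$, that is, a Markov chain on $V$ with transition probabilities $p(v,w)=1/d_v$ if $v$ and $w$ are adjacent and $p(v,w)=0$ otherwise (where $d_v$ is the degree of $v$), with an arbitrary distribution of $X_0$. Then $$\Pr\bigl(\{X_t : t\in\mathbb{Z},\ 0\le t\le Cn\}=V\bigr)<e^{-\varepsilon n}.$$ -/

import Mathlib

open MeasureTheory

/-- `X 0, X 1, …` is a (time-homogeneous) Markov chain on `V` with transition probabilities `p`,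
under the probability measure `μ` and with an arbitrary law of `X 0`: every `X t` is a random
variable with values in the discrete space `V`, and, given any history `x 0, …, x t`, the next state
is `x (t + 1)` with probability `p (x t) (x (t + 1))`. The conditional probability is written in
multiplied-out form, so that histories of probability zero impose nothing. -/
structure IsMarkovChain {V Ω : Type*} [MeasurableSpace Ω] (p : V → V → ℝ) (μ : Measure Ω)
    (X : ℕ → Ω → V) : Prop where
  measurableSet_eq : ∀ t v, MeasurableSet {ω | X t ω = v}
  markov : ∀ (t : ℕ) (x : ℕ → V),
    μ.real {ω | ∀ i ≤ t + 1, X i ω = x i} =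
      μ.real {ω | ∀ i ≤ t, X i ω = x i} * p (x t) (x (t + 1))

/-- Transition probabilities of simple random walk on `G`: from `v`, move to a uniformly random
neighbour of `v`. -/
noncomputable def walkProb {V : Type*} [Fintype V] (G : SimpleGraph V) [DecidableRel G.Adj]
    (v w : V) : ℝ :=
  if G.Adj v w then 1 / (G.degree v : ℝ) else 0

/-- `X 0, X 1, …` is a simple random walk on `G`, with any rule for `X 0`. -/
def IsRandomWalk {V Ω : Type*} [Fintype V] [MeasurableSpace Ω] (G : SimpleGraph V)
    [DecidableRel G.Adj] (μ : Measure Ω) (X : ℕ → Ω → V) : Prop :=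
  IsMarkovChain (walkProb G) μ X

/-! ### Harmonic measure and the watched (trace) chain -/

section HarmonicMeasure

variable {V : Type*} [Fintype V] [DecidableEq V]

/-! The walk is watched only at its visits to a suitable set `W`. Suppose every jump of the watched
chain into a large part `U` of `W`, from a different state, has probability at most a small `δ`.
After linearly many visits to `W` the jump probabilities into `U` add up to at most a linear total,
so a typical state of `U` has received bounded intensity and should still be missed with probability
bounded below. For levels `b u` fixed in advance, an exponential supermartingale makes this precise:
`IsMarkovChain.measureReal_cover_le` bounds the probability that `U` is covered while few
intensities exceed their levels. The actual intensities depend on the trajectory, but by empirical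
sampling they lie, with few exceptions, below levels computed from a multiset of a small multiple of
`|U|` states (`exists_card_sampleLevel_lt_le`). Such multisets are few enough for a union bound,
which gives `exists_measureReal_cover_le`.

It remains to find `W` and `U`. If few vertices have degree at most `D`, then `W` is everything and
`U` consists of the vertices all of whose neighbours have degree above `D`. Otherwise the low-degree
vertices are coloured with boundedly many colours (`exists_colouring`). A likely jump from `u` to
`v` within a class forces, by reversibility and bounded degree, a not too unlikely excursion from
`v` to `u` and back; putting `u` and `v` into different classes raises the return probability at `v`
by a fixed amount (`traceProb_self_add_le`). Return probabilities are at most one, so this energy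
increment stops after boundedly many refinements. Some class is then both large and not visited too
often.

This proves the bound up to a constant factor. For the remaining boundedly many sizes, the walk
oscillates along one edge with probability bounded below and so misses a third vertex. -/

/-- For the chain with transition probabilities `p` started at `x`, the probability that `W` is
reached in fewer than `k` steps, and first at `u`. -/
noncomputable def hitWithin (p : V → V → ℝ) (W : Finset V) : ℕ → V → V → ℝ
  | 0, _, _ => 0
  | k + 1, u, x =>
    if x ∈ W then (if x = u then 1 else 0) else ∑ y, p x y * hitWithin p W k u y

/-- Harmonic measure: the probability that the chain started at `x` first meets `W` at `u`. -/
noncomputable def hitProb (p : V → V → ℝ) (W : Finset V) (u x : V) : ℝ :=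
  ⨆ k, hitWithin p W k u x

/-- Transition probabilities of the chain watched on `W`. -/
noncomputable def traceProb (p : V → V → ℝ) (W : Finset V) (v u : V) : ℝ :=
  ∑ y, p v y * hitProb p W u y

variable {p : V → V → ℝ} {W : Finset V}

lemma hitWithin_nonneg (hp : ∀ x y, 0 ≤ p x y) (k : ℕ) (u x : V) : 0 ≤ hitWithin p W k u x := by
  induction k generalizing x with
  | zero => simp [hitWithin]
  | succ k ih =>
    rw [hitWithin]
    split_ifs
    · exact zero_le_one
    · exact le_rfl
    · exact Finset.sum_nonneg fun y _ => mul_nonneg (hp x y) (ih y)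

lemma hitWithin_le_one (hp : ∀ x y, 0 ≤ p x y) (hs : ∀ x, ∑ y, p x y ≤ 1) (k : ℕ) (u x : V) :
    hitWithin p W k u x ≤ 1 := by
  induction k generalizing x with
  | zero => simp [hitWithin]
  | succ k ih =>
    rw [hitWithin]
    split_ifs
    · exact le_rfl
    · exact zero_le_one
    · exact (Finset.sum_le_sum fun y _ => mul_le_of_le_one_right (hp x y) (ih y)).trans (hs x)

lemma hitWithin_le_succ (hp : ∀ x y, 0 ≤ p x y) (k : ℕ) (u x : V) :
    hitWithin p W k u x ≤ hitWithin p W (k + 1) u x := by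
  induction k generalizing x with
  | zero => simpa [hitWithin] using hitWithin_nonneg (W := W) hp 1 u x
  | succ k ih =>
    rw [hitWithin, hitWithin]
    split_ifs
    · exact le_rfl
    · exact le_rfl
    · exact Finset.sum_le_sum fun y _ => mul_le_mul_of_nonneg_left (ih y) (hp x y)

lemma tendsto_hitWithin (hp : ∀ x y, 0 ≤ p x y) (hs : ∀ x, ∑ y, p x y ≤ 1) (u x : V) :
    Filter.Tendsto (fun k => hitWithin p W k u x) Filter.atTop (nhds (hitProb p W u x)) :=
  tendsto_atTop_ciSup (monotone_nat_of_le_succ fun k => hitWithin_le_succ hp k u x)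
    ⟨1, by rintro _ ⟨k, rfl⟩; exact hitWithin_le_one hp hs k u x⟩

lemma hitProb_nonneg (hp : ∀ x y, 0 ≤ p x y) (hs : ∀ x, ∑ y, p x y ≤ 1) (u x : V) :
    0 ≤ hitProb p W u x :=
  ge_of_tendsto' (tendsto_hitWithin hp hs u x) fun k => hitWithin_nonneg hp k u x

lemma hitProb_of_mem (hp : ∀ x y, 0 ≤ p x y) (hs : ∀ x, ∑ y, p x y ≤ 1) (u : V) {x : V}
    (hx : x ∈ W) : hitProb p W u x = if x = u then 1 else 0 := by
  refine tendsto_nhds_unique ((Filter.tendsto_add_atTop_iff_nat 1).2 (tendsto_hitWithin hp hs u x))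
    ?_
  simp only [hitWithin, hx, if_true]
  exact tendsto_const_nhds

lemma hitProb_of_notMem (hp : ∀ x y, 0 ≤ p x y) (hs : ∀ x, ∑ y, p x y ≤ 1) (u : V) {x : V}
    (hx : x ∉ W) : hitProb p W u x = ∑ y, p x y * hitProb p W u y := by
  refine tendsto_nhds_unique ((Filter.tendsto_add_atTop_iff_nat 1).2 (tendsto_hitWithin hp hs u x))
    ?_
  simp only [hitWithin, hx, if_false]
  exact tendsto_finsetSum _ fun y _ => (tendsto_hitWithin hp hs u y).const_mul _

/-- Minimality of harmonic measure among nonnegative functions superharmonic off `W`. -/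
lemma sum_mul_hitProb_le (hp : ∀ x y, 0 ≤ p x y) (hs : ∀ x, ∑ y, p x y ≤ 1) {g : V → ℝ}
    (hg : ∀ x, 0 ≤ g x) (hg' : ∀ x ∉ W, ∑ y, p x y * g y ≤ g x) (x : V) :
    ∑ w ∈ W, g w * hitProb p W w x ≤ g x := by
  refine le_of_tendsto' (tendsto_finsetSum _ fun w _ => (tendsto_hitWithin hp hs w x).const_mul _)
    fun k => ?_
  induction k generalizing x with
  | zero => simpa [hitWithin] using hg x
  | succ k ih =>
    by_cases hx : x ∈ W
    · simp [hitWithin, hx]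
    · simp only [hitWithin, hx, if_false]
      calc ∑ w ∈ W, g w * ∑ y, p x y * hitWithin p W k w y
          = ∑ y, p x y * ∑ w ∈ W, g w * hitWithin p W k w y := by
            simp only [Finset.mul_sum]
            rw [Finset.sum_comm]
            exact Finset.sum_congr rfl fun _ _ => Finset.sum_congr rfl fun _ _ => by ring
        _ ≤ ∑ y, p x y * g y :=
            Finset.sum_le_sum fun y _ => mul_le_mul_of_nonneg_left (ih y) (hp x y)
        _ ≤ g x := hg' x hx

lemma sum_hitProb_le_one (hp : ∀ x y, 0 ≤ p x y) (hs : ∀ x, ∑ y, p x y ≤ 1) (x : V) :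
    ∑ w ∈ W, hitProb p W w x ≤ 1 := by
  simpa using sum_mul_hitProb_le (W := W) hp hs (g := fun _ => 1) (fun _ => zero_le_one)
    (fun x _ => by simpa using hs x) x

lemma traceProb_nonneg (hp : ∀ x y, 0 ≤ p x y) (hs : ∀ x, ∑ y, p x y ≤ 1) (v u : V) :
    0 ≤ traceProb p W v u :=
  Finset.sum_nonneg fun y _ => mul_nonneg (hp v y) (hitProb_nonneg hp hs u y)

lemma sum_traceProb_le_one (hp : ∀ x y, 0 ≤ p x y) (hs : ∀ x, ∑ y, p x y ≤ 1) (v : V) :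
    ∑ u ∈ W, traceProb p W v u ≤ 1 := by
  simp only [traceProb]
  rw [Finset.sum_comm]
  refine le_trans (Finset.sum_le_sum fun y _ => ?_) (hs v)
  rw [← Finset.mul_sum]
  exact mul_le_of_le_one_right (hp v y) (sum_hitProb_le_one hp hs y)

lemma traceProb_le_one (hp : ∀ x y, 0 ≤ p x y) (hs : ∀ x, ∑ y, p x y ≤ 1) (v : V) {u : V}
    (hu : u ∈ W) : traceProb p W v u ≤ 1 :=
  (Finset.single_le_sum (f := fun u => traceProb p W v u)
    (fun u _ => traceProb_nonneg hp hs v u) hu).trans (sum_traceProb_le_one hp hs v)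

lemma traceProb_univ (hp : ∀ x y, 0 ≤ p x y) (hs : ∀ x, ∑ y, p x y ≤ 1) (v u : V) :
    traceProb p Finset.univ v u = p v u := by
  simp [traceProb, hitProb_of_mem hp hs u (Finset.mem_univ _)]

/-- The watched chain of a reversible chain is reversible. -/
lemma traceProb_reversible (hp : ∀ x y, 0 ≤ p x y) (hs : ∀ x, ∑ y, p x y ≤ 1) {d : V → ℝ}
    (hd : ∀ x y, d x * p x y = d y * p y x) {u v : V} (hu : u ∈ W) (hv : v ∈ W) :
    d v * traceProb p W v u = d u * traceProb p W u v := by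
  -- Green's formula: off `W` the second function is harmonic, and on `W` the first vanishes except
  -- at `v`, so a single term survives.
  have green : ∀ {u v : V}, v ∈ W →
      ∑ x, d x * hitProb p W v x * (hitProb p W u x - ∑ y, p x y * hitProb p W u y) =
        d v * (hitProb p W u v - traceProb p W v u) := by
    intro u v hv
    rw [Finset.sum_eq_single v]
    · rw [hitProb_of_mem hp hs v hv, if_pos rfl, mul_one, traceProb]
    · intro x _ hxv
      by_cases hx : x ∈ W
      · rw [hitProb_of_mem hp hs v hx, if_neg hxv]; ring
      · rw [← hitProb_of_notMem hp hs u hx]; ring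
    · simp
  -- Detailed balance makes the bilinear form of `p` symmetric under the weight `d`.
  have symm : ∑ x, d x * hitProb p W v x * (∑ y, p x y * hitProb p W u y) =
      ∑ x, d x * hitProb p W u x * (∑ y, p x y * hitProb p W v y) := by
    simp only [Finset.mul_sum]
    rw [Finset.sum_comm]
    refine Finset.sum_congr rfl fun x _ => Finset.sum_congr rfl fun y _ => ?_
    linear_combination hitProb p W v y * hitProb p W u x * hd y x
  have h1 := green (u := u) hv
  have h2 := green (u := v) hu
  simp only [mul_sub, Finset.sum_sub_distrib] at h1 h2
  rw [symm] at h1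
  have h3 : ∑ x, d x * hitProb p W v x * hitProb p W u x =
      ∑ x, d x * hitProb p W u x * hitProb p W v x :=
    Finset.sum_congr rfl fun _ _ => by ring
  rw [hitProb_of_mem hp hs u hv] at h1
  rw [hitProb_of_mem hp hs v hu] at h2
  by_cases huv : u = v
  · rw [huv]
  · rw [if_neg (Ne.symm huv)] at h1
    rw [if_neg huv] at h2
    linarith

/-- One half of the strong Markov property at the first entrance into `W`. It is minimality applied
to `hitProb p W' v`, which is harmonic off `W'` and hence off `W`. -/
lemma le_hitProb_of_subset (hp : ∀ x y, 0 ≤ p x y) (hs : ∀ x, ∑ y, p x y ≤ 1) {W' : Finset V}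
    (hW : W' ⊆ W) (v x : V) :
    ∑ w ∈ W, hitProb p W' v w * hitProb p W w x ≤ hitProb p W' v x :=
  sum_mul_hitProb_le hp hs (hitProb_nonneg hp hs v)
    (fun _ hx => (hitProb_of_notMem hp hs v fun h => hx (hW h)).ge) x

/-- A path that first meets `W` at a point of `W'` also first meets `W'` there. -/
lemma traceProb_le_of_subset (hp : ∀ x y, 0 ≤ p x y) (hs : ∀ x, ∑ y, p x y ≤ 1)
    {W' : Finset V} (hW : W' ⊆ W) (x : V) {v : V} (hv : v ∈ W') :
    traceProb p W x v ≤ traceProb p W' x v := by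
  refine Finset.sum_le_sum fun y _ => mul_le_mul_of_nonneg_left ?_ (hp x y)
  refine le_trans ?_ (le_hitProb_of_subset hp hs hW v y)
  have := Finset.single_le_sum (f := fun w => hitProb p W' v w * hitProb p W w y)
    (fun w _ => mul_nonneg (hitProb_nonneg hp hs v w) (hitProb_nonneg hp hs w y)) (hW hv)
  simpa [hitProb_of_mem hp hs v hv] using this

/-- Watching fewer states increases the return probability: an excursion through a deleted state
`u` and back now counts as a return. -/
lemma traceProb_self_add_le (hp : ∀ x y, 0 ≤ p x y) (hs : ∀ x, ∑ y, p x y ≤ 1)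
    {W' : Finset V} (hW : W' ⊆ W) {u v : V} (hv : v ∈ W') (hu : u ∈ W) (hu' : u ∉ W') :
    traceProb p W v v + traceProb p W v u * traceProb p W u v ≤ traceProb p W' v v := by
  have huv : v ≠ u := fun h => hu' (h ▸ hv)
  have hc : traceProb p W u v ≤ hitProb p W' v u :=
    (traceProb_le_of_subset hp hs hW u hv).trans (hitProb_of_notMem hp hs v hu').ge
  calc traceProb p W v v + traceProb p W v u * traceProb p W u v
      ≤ traceProb p W v v + traceProb p W v u * hitProb p W' v u :=
        add_le_add_right (mul_le_mul_of_nonneg_left hc (traceProb_nonneg hp hs v u)) _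
    _ = ∑ y, p v y * (hitProb p W v y + hitProb p W' v u * hitProb p W u y) := by
        simp only [traceProb, Finset.sum_mul, mul_add, Finset.sum_add_distrib]
        congr 1
        exact Finset.sum_congr rfl fun _ _ => by ring
    _ ≤ traceProb p W' v v := by
        refine Finset.sum_le_sum fun y _ => mul_le_mul_of_nonneg_left ?_ (hp v y)
        refine le_trans ?_ (le_hitProb_of_subset hp hs hW v y)
        -- Of all first entrance points into `W`, only `v` and the deleted `u` are kept.
        have := Finset.sum_le_sum_of_subset_of_nonneg
          (f := fun w => hitProb p W' v w * hitProb p W w y) (s := {v, u}) (t := W)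
          (by simp [Finset.insert_subset_iff, hW hv, hu])
          (fun w _ _ => mul_nonneg (hitProb_nonneg hp hs v w) (hitProb_nonneg hp hs w y))
        rw [Finset.sum_pair huv] at this
        simpa [hitProb_of_mem hp hs v hv] using this

end HarmonicMeasure

/-! ### A maximal-type inequality for functions of the visit counts -/

section Supermartingale

lemma IsMarkovChain.sum_measureReal_eq_one {V Ω : Type*} [Fintype V] [MeasurableSpace Ω]
    {p : V → V → ℝ} {μ : Measure Ω}
    [IsProbabilityMeasure μ] {X : ℕ → Ω → V} (hX : IsMarkovChain p μ X) (t : ℕ) :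
    ∑ v, μ.real {ω | X t ω = v} = 1 := by
  have h : ∀ v, {ω | X t ω = v} = X t ⁻¹' {v} := fun v => by ext; simp
  have := sum_measureReal_preimage_singleton (μ := μ) (f := X t) Finset.univ
    (fun v _ => h v ▸ hX.measurableSet_eq t v)
  simpa [h] using this

variable {V Ω : Type*} [DecidableEq V]

/-- `visits x t v` is the number of times before `t` at which the trajectory `x` is at `v`. -/
def visits (x : ℕ → V) (t : ℕ) (v : V) : ℕ := ((Finset.range t).filter fun i => x i = v).card

lemma visits_zero (x : ℕ → V) : visits x 0 = 0 := by
  funext v; simp [visits]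

lemma visits_succ (x : ℕ → V) (t : ℕ) : visits x (t + 1) = visits x t + Pi.single (x t) 1 := by
  funext v
  simp only [visits, Finset.range_add_one, Finset.filter_insert, Pi.add_apply, Pi.single_apply]
  by_cases h : x t = v
  · simp [h]
  · simp [h, Ne.symm h]

lemma visits_congr {x y : ℕ → V} {t : ℕ} (h : ∀ i < t, x i = y i) : visits x t = visits y t := by
  funext v
  simp only [visits]
  congr 1
  exact Finset.filter_congr fun i hi => by rw [h i (Finset.mem_range.1 hi)]

variable [Fintype V] [MeasurableSpace Ω]

lemma sum_visits (x : ℕ → V) (t : ℕ) : ∑ v, visits x t v = t := by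
  simp only [visits]
  rw [← Finset.card_eq_sum_card_fiberwise (f := x) (fun _ _ => Finset.mem_coe.2 (Finset.mem_univ _)),
    Finset.card_range]

/-- Markov's inequality for a supermartingale, by induction on the number `k` of remaining steps
with the history up to `t` prescribed. Thus the multiplied-out Markov property suffices, and no
conditional expectation is needed. Only the values of `x` up to time `t` matter. -/
lemma IsMarkovChain.measureReal_le_of_history {p : V → V → ℝ} {μ : Measure Ω}
    [IsProbabilityMeasure μ] {X : ℕ → Ω → V} (hX : IsMarkovChain p μ X)
    {Ψ : (V → ℕ) → V → ℝ} (h0 : ∀ n x, 0 ≤ Ψ n x)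
    (hstep : ∀ n x, ∑ y, p x y * Ψ (n + Pi.single x 1) y ≤ Ψ n x) {a : ℝ} (ha : 0 < a)
    (k t : ℕ) (x : ℕ → V) :
    μ.real {ω | (∀ i ≤ t, X i ω = x i) ∧
        a ≤ Ψ (visits (fun i => X i ω) (t + k)) (X (t + k) ω)} ≤
      μ.real {ω | ∀ i ≤ t, X i ω = x i} * (Ψ (visits x t) (x t) / a) := by
  induction k generalizing t x with
  | zero =>
    by_cases h : a ≤ Ψ (visits x t) (x t)
    · refine (measureReal_mono fun ω hω => hω.1).trans ?_
      exact le_mul_of_one_le_right measureReal_nonneg ((one_le_div ha).2 h)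
    · have : {ω | (∀ i ≤ t, X i ω = x i) ∧
          a ≤ Ψ (visits (fun i => X i ω) (t + 0)) (X (t + 0) ω)} = ∅ := by
        ext ω
        simp only [add_zero, Set.mem_ofPred_eq, Set.mem_empty_iff_false, iff_false, not_and]
        intro hω
        rwa [visits_congr (y := x) fun i hi => hω i hi.le, hω t le_rfl]
      rw [this, measureReal_empty]
      exact mul_nonneg measureReal_nonneg (div_nonneg (h0 _ _) ha.le)
  | succ k ih =>
    have hupd : ∀ y, ∀ i ≤ t, Function.update x (t + 1) y i = x i := fun y i hi =>
      Function.update_of_ne (by omega) _ _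
    calc _ ≤ μ.real (⋃ y, {ω | (∀ i ≤ t + 1, X i ω = Function.update x (t + 1) y i) ∧
          a ≤ Ψ (visits (fun i => X i ω) (t + 1 + k)) (X (t + 1 + k) ω)}) := by
          refine measureReal_mono fun ω hω => Set.mem_iUnion.2 ⟨X (t + 1) ω, ?_, ?_⟩
          · intro i hi
            rcases Nat.le_succ_iff.1 hi with h | rfl
            · rw [hupd _ i h, hω.1 i h]
            · simp
          · have := hω.2
            rwa [show t + (k + 1) = t + 1 + k by ring] at this
      _ ≤ ∑ y, μ.real {ω | (∀ i ≤ t + 1, X i ω = Function.update x (t + 1) y i) ∧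
          a ≤ Ψ (visits (fun i => X i ω) (t + 1 + k)) (X (t + 1 + k) ω)} :=
          measureReal_iUnion_fintype_le _
      _ ≤ ∑ y, μ.real {ω | ∀ i ≤ t, X i ω = x i} *
          (p (x t) y * Ψ (visits x t + Pi.single (x t) 1) y / a) := by
          refine Finset.sum_le_sum fun y _ => (ih (t + 1) (Function.update x (t + 1) y)).trans ?_
          rw [hX.markov, visits_succ, hupd y t le_rfl, Function.update_self,
            visits_congr (y := x) fun i hi => hupd y i hi.le]
          have : {ω | ∀ i ≤ t, X i ω = Function.update x (t + 1) y i} =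
              {ω | ∀ i ≤ t, X i ω = x i} := by
            ext ω
            exact forall₂_congr fun i hi => by rw [hupd y i hi]
          rw [this]
          exact le_of_eq (by ring)
      _ ≤ _ := by
          rw [← Finset.mul_sum, ← Finset.sum_div]
          have := hstep (visits x t) (x t)
          gcongr

/-- Maximal-type inequality for a nonnegative function of the visit counts and the current state
that decreases on average. -/
lemma IsMarkovChain.measureReal_le {p : V → V → ℝ} {μ : Measure Ω}
    [IsProbabilityMeasure μ] {X : ℕ → Ω → V} (hX : IsMarkovChain p μ X)
    {Ψ : (V → ℕ) → V → ℝ} (h0 : ∀ n x, 0 ≤ Ψ n x)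
    (hstep : ∀ n x, ∑ y, p x y * Ψ (n + Pi.single x 1) y ≤ Ψ n x) {a : ℝ} (ha : 0 < a)
    {b : ℝ} (hb : ∀ x, Ψ 0 x ≤ b) (t : ℕ) :
    μ.real {ω | a ≤ Ψ (visits (fun i => X i ω) t) (X t ω)} ≤ b / a := by
  calc _ ≤ μ.real (⋃ v, {ω | (∀ i ≤ 0, X i ω = v) ∧
        a ≤ Ψ (visits (fun i => X i ω) (0 + t)) (X (0 + t) ω)}) := by
        refine measureReal_mono fun ω hω => Set.mem_iUnion.2 ⟨X 0 ω, ?_, ?_⟩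
        · simp
        · simpa using hω
    _ ≤ ∑ v, μ.real {ω | (∀ i ≤ 0, X i ω = v) ∧
        a ≤ Ψ (visits (fun i => X i ω) (0 + t)) (X (0 + t) ω)} := measureReal_iUnion_fintype_le _
    _ ≤ ∑ v, μ.real {ω | X 0 ω = v} * (b / a) := by
        refine Finset.sum_le_sum fun v _ =>
          (hX.measureReal_le_of_history h0 hstep ha t 0 fun _ => v).trans ?_
        simp only [nonpos_iff_eq_zero, forall_eq, visits_zero]
        have := hb v
        gcongr
    _ = b / a := by rw [← Finset.sum_mul, hX.sum_measureReal_eq_one, one_mul]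

end Supermartingale

/-! ### The exponential supermartingale for fixed levels -/

section Potential

variable {V Ω : Type*} [Fintype V] [DecidableEq V] [MeasurableSpace Ω]

/-- Transition probabilities of the watched chain between distinct states, extended by zero. -/
noncomputable def jumpProb (p : V → V → ℝ) (W : Finset V) (v u : V) : ℝ :=
  if v ∈ W ∧ v ≠ u then traceProb p W v u else 0

/-- Total probability with which the chain watched on `W` has jumped to `u`, when the numbers of
visits are `n`. -/
noncomputable def intensity (p : V → V → ℝ) (W : Finset V) (n : V → ℕ) (u : V) : ℝ :=
  ∑ v, n v * jumpProb p W v u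

/-- Weight of the state `u`: it grows with the intensity up to level `b` as long as `u` is
unvisited, vanishes at the first visit, and is `1` once the intensity exceeds `b`. -/
noncomputable def weight (p : V → V → ℝ) (W : Finset V) (b : V → ℝ) (n : V → ℕ) (u : V) : ℝ :=
  if b u < intensity p W n u then 1
  else if n u = 0 then Real.exp (2 * (intensity p W n u - b u)) else 0

/-- Relative gain of the potential at the first visit to `u`. -/
noncomputable def gain (p : V → V → ℝ) (W : Finset V) (b : V → ℝ) (l : ℝ) (n : V → ℕ) (u : V) : ℝ :=
  if intensity p W n u ≤ b u ∧ n u = 0 then Real.exp (l * weight p W b n u) - 1 else 0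

/-- The exponential potential whose mean decreases along the chain. -/
noncomputable def potential (p : V → V → ℝ) (W U : Finset V) (b : V → ℝ) (l : ℝ) (n : V → ℕ)
    (x : V) : ℝ :=
  Real.exp (-l * ∑ u ∈ U, weight p W b n u - l ^ 2 * ∑ v ∈ W, (n v : ℝ)) *
    (1 + ∑ u ∈ U, gain p W b l n u * hitProb p W u x)

variable {p : V → V → ℝ} {W U : Finset V} {b : V → ℝ} {l : ℝ}

lemma jumpProb_nonneg (hp : ∀ x y, 0 ≤ p x y) (hs : ∀ x, ∑ y, p x y ≤ 1) (v u : V) :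
    0 ≤ jumpProb p W v u := by
  rw [jumpProb]
  split_ifs
  exacts [traceProb_nonneg hp hs v u, le_rfl]

lemma jumpProb_le (hp : ∀ x y, 0 ≤ p x y) (hs : ∀ x, ∑ y, p x y ≤ 1) (v u : V) :
    jumpProb p W v u ≤ traceProb p W v u := by
  rw [jumpProb]
  split_ifs
  exacts [le_rfl, traceProb_nonneg hp hs v u]

lemma sum_jumpProb_le_one (hp : ∀ x y, 0 ≤ p x y) (hs : ∀ x, ∑ y, p x y ≤ 1) (hU : U ⊆ W) (v : V) :
    ∑ u ∈ U, jumpProb p W v u ≤ 1 :=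
  calc _ ≤ ∑ u ∈ U, traceProb p W v u := Finset.sum_le_sum fun u _ => jumpProb_le hp hs v u
    _ ≤ ∑ u ∈ W, traceProb p W v u :=
      Finset.sum_le_sum_of_subset_of_nonneg hU fun u _ _ => traceProb_nonneg hp hs v u
    _ ≤ 1 := sum_traceProb_le_one hp hs v

lemma intensity_add_single (n : V → ℕ) (x u : V) :
    intensity p W (n + Pi.single x 1) u = intensity p W n u + jumpProb p W x u := by
  simp only [intensity, Pi.add_apply, Nat.cast_add, add_mul, Finset.sum_add_distrib]
  congr 1
  rw [Finset.sum_eq_single x]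
  · simp
  · intro v _ hv
    simp [Pi.single_eq_of_ne hv]
  · simp

lemma weight_nonneg (n : V → ℕ) (u : V) : 0 ≤ weight p W b n u := by
  rw [weight]
  split_ifs
  exacts [zero_le_one, (Real.exp_pos _).le, le_rfl]

lemma weight_le_one (n : V → ℕ) (u : V) : weight p W b n u ≤ 1 := by
  rw [weight]
  split_ifs with h1
  exacts [le_rfl, Real.exp_le_one_iff.2 (by linarith), zero_le_one]

lemma gain_nonneg (hl : 0 ≤ l) (n : V → ℕ) (u : V) : 0 ≤ gain p W b l n u := by
  rw [gain]
  split_ifs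
  · linarith [Real.one_le_exp (mul_nonneg hl (weight_nonneg (p := p) (W := W) (b := b) n u))]
  · exact le_rfl

lemma potential_nonneg (hp : ∀ x y, 0 ≤ p x y) (hs : ∀ x, ∑ y, p x y ≤ 1) (hl : 0 ≤ l)
    (n : V → ℕ) (x : V) : 0 ≤ potential p W U b l n x :=
  mul_nonneg (Real.exp_pos _).le (add_nonneg zero_le_one (Finset.sum_nonneg fun u _ =>
    mul_nonneg (gain_nonneg hl n u) (hitProb_nonneg hp hs u x)))

/-- Averages the second factor of `potential` over one step: hitting probabilities become watched
transition probabilities. -/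
lemma sum_mul_one_add_sum_le (hs : ∀ x, ∑ y, p x y ≤ 1) (k : V → ℝ) (x : V) :
    ∑ y, p x y * (1 + ∑ u ∈ U, k u * hitProb p W u y) ≤ 1 + ∑ u ∈ U, k u * traceProb p W x u := by
  have : ∑ y, p x y * (1 + ∑ u ∈ U, k u * hitProb p W u y) =
      ∑ y, p x y + ∑ u ∈ U, k u * traceProb p W x u := by
    simp only [mul_add, mul_one, Finset.sum_add_distrib, traceProb, Finset.mul_sum]
    rw [Finset.sum_comm (s := Finset.univ)]
    congr 1
    exact Finset.sum_congr rfl fun _ _ => Finset.sum_congr rfl fun _ _ => by ring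
  rw [this]
  exact add_le_add_left (hs x) _

/-- Visits off `W` change neither weights nor gains, and the hitting probabilities are harmonic
there. -/
lemma potential_step_of_notMem (hp : ∀ x y, 0 ≤ p x y) (hs : ∀ x, ∑ y, p x y ≤ 1)
    (hU : U ⊆ W) (n : V → ℕ) {x : V} (hx : x ∉ W) :
    ∑ y, p x y * potential p W U b l (n + Pi.single x 1) y ≤ potential p W U b l n x := by
  have hi : ∀ u, intensity p W (n + Pi.single x 1) u = intensity p W n u := fun u => by
    rw [intensity_add_single, jumpProb, if_neg (fun h => hx h.1), add_zero]
  have hn : ∀ u ∈ W, (n + Pi.single x 1 : V → ℕ) u = n u := fun u hu => by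
    simp [Pi.single_eq_of_ne (show u ≠ x from fun h => hx (h ▸ hu))]
  have hw : ∀ u ∈ U, weight p W b (n + Pi.single x 1) u = weight p W b n u := fun u hu => by
    simp only [weight, hi, hn u (hU hu)]
  have hg : ∀ u ∈ U, gain p W b l (n + Pi.single x 1) u = gain p W b l n u := fun u hu => by
    simp only [gain, hi, hn u (hU hu), hw u hu]
  have hpot : ∀ y, potential p W U b l (n + Pi.single x 1) y =
      Real.exp (-l * ∑ u ∈ U, weight p W b n u - l ^ 2 * ∑ v ∈ W, (n v : ℝ)) *
        (1 + ∑ u ∈ U, gain p W b l n u * hitProb p W u y) := fun y => by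
    have hN : ∑ v ∈ W, ((n + Pi.single x 1 : V → ℕ) v : ℝ) = ∑ v ∈ W, (n v : ℝ) :=
      Finset.sum_congr rfl fun v hv => by rw [hn v hv]
    have hG : ∑ u ∈ U, gain p W b l (n + Pi.single x 1) u * hitProb p W u y =
        ∑ u ∈ U, gain p W b l n u * hitProb p W u y :=
      Finset.sum_congr rfl fun u hu => by rw [hg u hu]
    rw [potential, Finset.sum_congr rfl hw, hN, hG]
  simp only [hpot, mul_left_comm (p x _)]
  rw [← Finset.mul_sum, potential]
  refine mul_le_mul_of_nonneg_left ((sum_mul_one_add_sum_le hs _ x).trans ?_) (Real.exp_pos _).le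
  refine add_le_add_right (Finset.sum_le_sum fun u _ => ?_) _
  rw [traceProb, ← hitProb_of_notMem hp hs u hx]

/-- Balance of the weight, the gain and the drift of a single state `u` in a step from `x`. -/
lemma weight_balance (hp : ∀ x y, 0 ≤ p x y) (hs : ∀ x, ∑ y, p x y ≤ 1) (hl : 0 ≤ l)
    (hl1 : l ≤ 1) (n : V → ℕ) {x u : V} (hx : x ∈ W) (hsmall : x ≠ u → traceProb p W x u ≤ 1 / 2) :
    gain p W b l (n + Pi.single x 1) u * traceProb p W x u + l * weight p W b n u ≤
      l * weight p W b (n + Pi.single x 1) u +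
        (if x = u then Real.log (1 + gain p W b l n u) else 0) + l ^ 2 * traceProb p W x u := by
  have hq := traceProb_nonneg (W := W) hp hs x u
  have hlq : 0 ≤ l ^ 2 * traceProb p W x u := by positivity
  by_cases hxu : x = u
  · subst hxu
    have hi : intensity p W (n + Pi.single x 1) x = intensity p W n x := by
      rw [intensity_add_single, jumpProb, if_neg (fun h => h.2 rfl), add_zero]
    have hg : gain p W b l (n + Pi.single x 1) x = 0 := by
      rw [gain, if_neg]; simp
    rw [hg, if_pos rfl, zero_mul, zero_add]
    by_cases h1 : b x < intensity p W n x
    · have hg' : gain p W b l n x = 0 := by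
        rw [gain, if_neg fun h => absurd h.1 (not_le.2 h1)]
      simp only [weight, hi, h1, if_true, hg', add_zero, Real.log_one]
      linarith
    · by_cases h2 : n x = 0
      -- At a first visit the gain already contained in the potential pays exactly for the lost
      -- weight.
      · have hg' : gain p W b l n x = Real.exp (l * weight p W b n x) - 1 := by
          rw [gain, if_pos ⟨not_lt.1 h1, h2⟩]
        rw [hg', add_sub_cancel, Real.log_exp]
        have := mul_nonneg hl (weight_nonneg (p := p) (W := W) (b := b) (n + Pi.single x 1) x)
        linarith
      · have hg' : gain p W b l n x = 0 := by
          rw [gain, if_neg fun h => h2 h.2]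
        have hw : weight p W b n x = 0 := by rw [weight, if_neg h1, if_neg h2]
        rw [hg', hw, add_zero, Real.log_one]
        have := mul_nonneg hl (weight_nonneg (p := p) (W := W) (b := b) (n + Pi.single x 1) x)
        linarith
  · have hq2 := hsmall hxu
    set q := traceProb p W x u with hqdef
    have hi : intensity p W (n + Pi.single x 1) u = intensity p W n u + q := by
      rw [intensity_add_single, jumpProb, if_pos ⟨hx, hxu⟩]
    have hn : (n + Pi.single x 1 : V → ℕ) u = n u := by
      simp [Pi.single_eq_of_ne (Ne.symm hxu)]
    rw [if_neg hxu, add_zero]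
    -- Once the intensity passes its level, the weight is at its maximum and the gain is switched
    -- off.
    by_cases h1 : b u < intensity p W n u + q
    · have hg : gain p W b l (n + Pi.single x 1) u = 0 := by
        rw [gain, if_neg fun h => absurd h.1 (by rw [hi]; exact not_le.2 h1)]
      have hw : weight p W b (n + Pi.single x 1) u = 1 := by rw [weight, hi, if_pos h1]
      rw [hg, hw, zero_mul, zero_add]
      have := mul_le_mul_of_nonneg_left (weight_le_one (p := p) (W := W) (b := b) n u) hl
      linarith
    · have h1' : ¬ b u < intensity p W n u := by linarith
      by_cases h2 : n u = 0
      · set a' := weight p W b (n + Pi.single x 1) u with ha'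
        have hw' : a' = Real.exp (2 * (intensity p W n u + q - b u)) := by
          rw [ha', weight, hi, if_neg h1, hn, if_pos h2]
        have hg : gain p W b l (n + Pi.single x 1) u = Real.exp (l * a') - 1 := by
          rw [gain, if_pos ⟨by rw [hi]; exact not_lt.1 h1, by rw [hn, h2]⟩]
        have hw : weight p W b n u * Real.exp (2 * q) = a' := by
          rw [weight, if_neg h1', if_pos h2, hw', ← Real.exp_add]
          congr 1; ring
        have ha0 : 0 ≤ a' := weight_nonneg _ _
        have ha1 : a' ≤ 1 := weight_le_one _ _
        have hw0 : 0 ≤ weight p W b n u := weight_nonneg _ _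
        -- The second-order error `l ^ 2` is what the visit term of `potential` later absorbs.
        have hexp : Real.exp (l * a') - 1 ≤ l * a' + l ^ 2 := by
          have hla : 0 ≤ l * a' := mul_nonneg hl ha0
          have hla' : l * a' ≤ l := mul_le_of_le_one_right hl ha1
          have := (abs_le.1 (Real.abs_exp_sub_one_sub_id_le (x := l * a')
            (by rw [abs_of_nonneg hla]; linarith))).2
          nlinarith
        -- Growth by `exp (2 * q)` outweighs dropping to zero with probability `q`, since `(1 + 2 *
        -- q) * (1 - q) ≥ 1` for `0 ≤ q ≤ 1 / 2`. Hence the rate `2` in `weight` and the bound `1 /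
        -- 2` on jumps.
        have hdrift : weight p W b n u ≤ a' * (1 - q) := by
          have h3 : 1 ≤ Real.exp (2 * q) * (1 - q) := by
            have := Real.add_one_le_exp (2 * q)
            nlinarith
          rw [← hw, mul_assoc]
          exact le_mul_of_one_le_right hw0 h3
        rw [hg]
        have h4 := mul_le_mul_of_nonneg_right hexp hq
        have h5 := mul_le_mul_of_nonneg_left hdrift hl
        nlinarith
      · have hg : gain p W b l (n + Pi.single x 1) u = 0 := by
          rw [gain, if_neg fun h => h2 (by rw [← hn]; exact h.2)]
        have hw : weight p W b n u = 0 := by rw [weight, if_neg h1', if_neg h2]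
        rw [hg, hw]
        have := mul_nonneg hl (weight_nonneg (p := p) (W := W) (b := b) (n + Pi.single x 1) u)
        linarith

/-- By `1 + s ≤ exp s` the claim becomes linear in the exponents and is the sum of `weight_balance`
over `U`. The errors add up to at most `l ^ 2`, because the watched transition probabilities have
total mass at most one, and the counted visit to `x` pays for them. -/
lemma potential_step_of_mem (hp : ∀ x y, 0 ≤ p x y) (hs : ∀ x, ∑ y, p x y ≤ 1)
    (hU : U ⊆ W) (hl : 0 ≤ l) (hl1 : l ≤ 1) (n : V → ℕ) {x : V} (hx : x ∈ W)
    (hsmall : ∀ u ∈ U, x ≠ u → traceProb p W x u ≤ 1 / 2) :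
    ∑ y, p x y * potential p W U b l (n + Pi.single x 1) y ≤ potential p W U b l n x := by
  have hN : ∑ v ∈ W, ((n + Pi.single x 1 : V → ℕ) v : ℝ) = ∑ v ∈ W, (n v : ℝ) + 1 := by
    simp only [Pi.add_apply, Nat.cast_add, Finset.sum_add_distrib]
    congr 1
    rw [Finset.sum_eq_single x]
    · simp
    · intro v _ hv; simp [Pi.single_eq_of_ne hv]
    · exact fun h => absurd hx h
  have hR : 1 + ∑ u ∈ U, gain p W b l n u * hitProb p W u x =
      Real.exp (∑ u ∈ U, if x = u then Real.log (1 + gain p W b l n u) else 0) := by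
    simp only [hitProb_of_mem hp hs _ hx, mul_ite, mul_one, mul_zero, Finset.sum_ite_eq]
    split_ifs
    · rw [Real.exp_log (by linarith [gain_nonneg (p := p) (W := W) (b := b) hl n x])]
    · simp
  simp only [potential, mul_left_comm (p x _)]
  rw [← Finset.mul_sum, hR, hN, ← Real.exp_add]
  refine (mul_le_mul_of_nonneg_left ((sum_mul_one_add_sum_le hs _ x).trans
    ((add_comm _ _).trans_le (Real.add_one_le_exp _))) (Real.exp_pos _).le).trans ?_
  rw [← Real.exp_add]
  refine Real.exp_le_exp.2 ?_
  have hsum := Finset.sum_le_sum fun u (hu : u ∈ U) =>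
    weight_balance (b := b) hp hs hl hl1 n hx (hsmall u hu)
  simp only [Finset.sum_add_distrib, ← Finset.mul_sum] at hsum
  have hq : ∑ u ∈ U, traceProb p W x u ≤ 1 :=
    (Finset.sum_le_sum_of_subset_of_nonneg hU fun u _ _ => traceProb_nonneg hp hs x u).trans
      (sum_traceProb_le_one hp hs x)
  have := mul_le_mul_of_nonneg_left hq (sq_nonneg l)
  linarith

/-- The states of `U` are unlikely to be covered while most of their intensities stay below `b`. -/
lemma IsMarkovChain.measureReal_cover_le {μ : Measure Ω} [IsProbabilityMeasure μ] {X : ℕ → Ω → V}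
    (hX : IsMarkovChain p μ X) (hp : ∀ x y, 0 ≤ p x y) (hs : ∀ x, ∑ y, p x y ≤ 1) (hU : U ⊆ W)
    (hsmall : ∀ x ∈ W, ∀ u ∈ U, x ≠ u → traceProb p W x u ≤ 1 / 2) (hl : 0 ≤ l) (hl1 : l ≤ 1)
    (hb : ∀ u, 0 ≤ b u) (r K : ℝ) (t : ℕ) :
    μ.real {ω | (∀ u ∈ U, visits (fun i => X i ω) t u ≠ 0) ∧
        ∑ v ∈ W, (visits (fun i => X i ω) t v : ℝ) ≤ K ∧
        ((U.filter fun u => b u < intensity p W (visits (fun i => X i ω) t) u).card : ℝ) ≤ r} ≤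
      Real.exp (l - l * ∑ u ∈ U, Real.exp (-2 * b u) + l * r + l ^ 2 * K) := by
  have hΨ := hX.measureReal_le (Ψ := potential p W U b l) (potential_nonneg hp hs hl)
    (fun n x => by
      by_cases hx : x ∈ W
      · exact potential_step_of_mem hp hs hU hl hl1 n hx (hsmall x hx)
      · exact potential_step_of_notMem hp hs hU n hx)
    (Real.exp_pos (-l * r - l ^ 2 * K)) (b := Real.exp (l - l * ∑ u ∈ U, Real.exp (-2 * b u)))
    (fun x => ?_) t
  · rw [← Real.exp_sub] at hΨ
    refine (measureReal_mono fun ω hω => ?_).trans (hΨ.trans_eq (by congr 1; ring))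
    obtain ⟨h1, h2, h3⟩ := hω
    simp only [Set.mem_ofPred_eq]
    set n := visits (fun i => X i ω) t
    -- When all of `U` has been visited, each weight is the indicator of an exceeded level.
    have hw : ∑ u ∈ U, weight p W b n u ≤ r := by
      refine le_trans (le_of_eq ?_) h3
      rw [Finset.card_filter, Nat.cast_sum]
      refine Finset.sum_congr rfl fun u hu => ?_
      rw [weight, if_neg (h1 u hu)]
      split_ifs <;> simp
    calc Real.exp (-l * r - l ^ 2 * K)
        ≤ Real.exp (-l * ∑ u ∈ U, weight p W b n u - l ^ 2 * ∑ v ∈ W, (n v : ℝ)) := by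
          refine Real.exp_le_exp.2 ?_
          have := mul_le_mul_of_nonneg_left hw hl
          have := mul_le_mul_of_nonneg_left h2 (sq_nonneg l)
          linarith
      _ ≤ _ := le_mul_of_one_le_right (Real.exp_pos _).le
          (le_add_of_nonneg_right (Finset.sum_nonneg fun u _ =>
            mul_nonneg (gain_nonneg hl n u) (hitProb_nonneg hp hs u _)))
  · have hi : ∀ u, intensity p W 0 u = 0 := fun u => by simp [intensity]
    have hw : ∀ u, weight p W b 0 u = Real.exp (-2 * b u) := fun u => by
      rw [weight, hi, if_neg (not_lt.2 (hb u)), if_pos (Pi.zero_apply u)]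
      congr 1; ring
    have hg : ∀ u, gain p W b l 0 u ≤ Real.exp l - 1 := fun u => by
      rw [gain]
      split_ifs
      · exact sub_le_sub_right (Real.exp_le_exp.2
          (mul_le_of_le_one_right hl (weight_le_one _ _))) _
      · linarith [Real.one_le_exp hl]
    -- The state at time `0` is not yet counted as visited; its possible gain costs the factor `exp
    -- l`.
    have hsum : ∑ u ∈ U, gain p W b l 0 u * hitProb p W u x ≤ Real.exp l - 1 :=
      calc _ ≤ ∑ u ∈ U, (Real.exp l - 1) * hitProb p W u x :=
            Finset.sum_le_sum fun u _ => mul_le_mul_of_nonneg_right (hg u)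
              (hitProb_nonneg hp hs u x)
        _ = (Real.exp l - 1) * ∑ u ∈ U, hitProb p W u x := by rw [Finset.mul_sum]
        _ ≤ Real.exp l - 1 := mul_le_of_le_one_right (by linarith [Real.one_le_exp hl])
            ((Finset.sum_le_sum_of_subset_of_nonneg hU fun u _ _ =>
              hitProb_nonneg hp hs u x).trans (sum_hitProb_le_one hp hs x))
    rw [potential]
    simp only [hw, Pi.zero_apply, Nat.cast_zero, Finset.sum_const_zero, mul_zero, sub_zero]
    rw [sub_eq_add_neg, add_comm l, Real.exp_add, ← neg_mul]
    exact mul_le_mul_of_nonneg_left (by linarith) (Real.exp_pos _).le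

end Potential

/-! ### Empirical sampling of intensities and the union bound -/

section Sampling

/-- An average of the vectors `Q v` is approximated in `ℓ²` by an average of few of them. -/
lemma exists_sym_sum_sq_le {V : Type*} {W U : Finset V} {n : V → ℕ} {Q : V → V → ℝ} {δ : ℝ}
    (hn : 0 < ∑ v ∈ W, (n v : ℝ)) (hQ0 : ∀ v u, 0 ≤ Q v u) (hδ : 0 ≤ δ)
    (hQδ : ∀ v ∈ W, ∀ u ∈ U, Q v u ≤ δ) (hQ1 : ∀ v, ∑ u ∈ U, Q v u ≤ 1) (m : ℕ) :
    ∃ s : Sym W m, ∑ u ∈ U, (((s : Multiset W).map fun v : W => Q v u).sum -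
      m * ((∑ v ∈ W, n v * Q v u) / ∑ v ∈ W, (n v : ℝ))) ^ 2 ≤ m * δ := by
  induction m with
  | zero => exact ⟨Sym.nil, by simp⟩
  | succ m ih =>
    obtain ⟨s, hs⟩ := ih
    set k := ∑ v ∈ W, (n v : ℝ) with hk
    set D : V → ℝ := fun u => ((s : Multiset W).map fun v : W => Q v u).sum -
      m * ((∑ v ∈ W, n v * Q v u) / k) with hD
    set e : V → ℝ := fun u => (∑ v ∈ W, n v * Q v u) / k with he
    have hek : ∀ u, ∑ v ∈ W, n v * Q v u = k * e u := fun u => by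
      rw [he]; field_simp
    -- First-moment choice of the next sample: for `v` drawn with law `n v / k` the mean of `Q v u`
    -- is `e u`, so the cross term vanishes. The variances sum to at most `δ`, by `Q ^ 2 ≤ δ * Q`
    -- and total mass at most one.
    have key : ∃ v ∈ W, ∑ u ∈ U, (D u + Q v u - e u) ^ 2 ≤ ∑ u ∈ U, D u ^ 2 + δ := by
      by_contra! hcon
      have h1 : ∑ v ∈ W, (n v : ℝ) * (∑ u ∈ U, D u ^ 2 + δ) <
          ∑ v ∈ W, (n v : ℝ) * ∑ u ∈ U, (D u + Q v u - e u) ^ 2 := by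
        obtain ⟨v, hv, hv'⟩ : ∃ v ∈ W, 0 < (n v : ℝ) := by
          by_contra! h
          exact absurd hn (not_lt.2 (Finset.sum_nonpos h))
        exact Finset.sum_lt_sum (fun v hv => mul_le_mul_of_nonneg_left (hcon v hv).le (by positivity))
          ⟨v, hv, mul_lt_mul_of_pos_left (hcon v hv) hv'⟩
      have h2 : ∀ u ∈ U, ∑ v ∈ W, (n v : ℝ) * (D u + Q v u - e u) ^ 2 ≤
          k * D u ^ 2 + δ * ∑ v ∈ W, n v * Q v u := by
        intro u hu
        have h3 : ∑ v ∈ W, (n v : ℝ) * (D u + Q v u - e u) ^ 2 =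
            (D u - e u) ^ 2 * ∑ v ∈ W, (n v : ℝ) + 2 * (D u - e u) * ∑ v ∈ W, n v * Q v u +
              ∑ v ∈ W, n v * Q v u ^ 2 := by
          rw [Finset.mul_sum, Finset.mul_sum, ← Finset.sum_add_distrib, ← Finset.sum_add_distrib]
          exact Finset.sum_congr rfl fun v _ => by ring
        have h4 : ∑ v ∈ W, n v * Q v u ^ 2 ≤ δ * ∑ v ∈ W, n v * Q v u := by
          rw [Finset.mul_sum]
          refine Finset.sum_le_sum fun v hv => ?_
          have h5 := mul_le_mul_of_nonneg_left (hQδ v hv u hu)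
            (mul_nonneg (Nat.cast_nonneg (α := ℝ) (n v)) (hQ0 v u))
          nlinarith
        rw [h3, ← hk]
        have h6 : 0 ≤ k * e u ^ 2 := mul_nonneg hn.le (sq_nonneg _)
        have h7 := hek u
        rw [h7] at h4 ⊢
        nlinarith
      have h8 : ∑ v ∈ W, (n v : ℝ) * ∑ u ∈ U, (D u + Q v u - e u) ^ 2 ≤
          k * ∑ u ∈ U, D u ^ 2 + δ * k :=
        calc ∑ v ∈ W, (n v : ℝ) * ∑ u ∈ U, (D u + Q v u - e u) ^ 2
            = ∑ u ∈ U, ∑ v ∈ W, (n v : ℝ) * (D u + Q v u - e u) ^ 2 := by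
              simp only [Finset.mul_sum]; exact Finset.sum_comm
          _ ≤ ∑ u ∈ U, (k * D u ^ 2 + δ * ∑ v ∈ W, n v * Q v u) := Finset.sum_le_sum h2
          _ = k * ∑ u ∈ U, D u ^ 2 + δ * ∑ v ∈ W, n v * ∑ u ∈ U, Q v u := by
              rw [Finset.sum_add_distrib, ← Finset.mul_sum, ← Finset.mul_sum]
              simp only [Finset.mul_sum]
              rw [Finset.sum_comm (s := U) (t := W)]
          _ ≤ _ := by
              refine add_le_add_right (mul_le_mul_of_nonneg_left ?_ hδ) _
              exact Finset.sum_le_sum fun v _ =>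
                mul_le_of_le_one_right (Nat.cast_nonneg _) (hQ1 v)
      rw [← Finset.sum_mul, ← hk] at h1
      linarith
    obtain ⟨v, hv, hle⟩ := key
    refine ⟨(⟨v, hv⟩ : W) ::ₛ s, ?_⟩
    calc _ = ∑ u ∈ U, (D u + Q v u - e u) ^ 2 := by
          refine Finset.sum_congr rfl fun u _ => ?_
          rw [Sym.coe_cons, Multiset.map_cons, Multiset.sum_cons]
          simp only [hD, he]
          push_cast
          ring
      _ ≤ _ := by
          push_cast
          linarith

variable {V Ω : Type*} [Fintype V] [DecidableEq V] [MeasurableSpace Ω]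

/-- The threshold given by a sample `s` of `m` states standing for `K` visits. -/
noncomputable def sampleLevel (p : V → V → ℝ) (W : Finset V) (K : ℝ) {m : ℕ} (s : Sym W m) (u : V) :
    ℝ :=
  K / m * ((s : Multiset W).map fun v : W => jumpProb p W v u).sum + 1

variable {p : V → V → ℝ} {W U : Finset V}

lemma intensity_eq_sum (n : V → ℕ) (u : V) :
    intensity p W n u = ∑ v ∈ W, n v * jumpProb p W v u := by
  rw [intensity]
  refine (Finset.sum_subset (Finset.subset_univ W) fun v _ hv => ?_).symm
  rw [jumpProb, if_neg fun h => hv h.1, mul_zero]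

lemma sampleLevel_nonneg (hp : ∀ x y, 0 ≤ p x y) (hs : ∀ x, ∑ y, p x y ≤ 1) {K : ℝ} (hK : 0 ≤ K)
    {m : ℕ} (s : Sym W m) (u : V) : 0 ≤ sampleLevel p W K s u := by
  refine add_nonneg (mul_nonneg (by positivity) (Multiset.sum_nonneg ?_)) zero_le_one
  intro a ha
  obtain ⟨v, _, rfl⟩ := Multiset.mem_map.1 ha
  exact jumpProb_nonneg hp hs _ _

/-- Chebyshev's inequality, counted over `U`: the summand `1` in `sampleLevel` forces a deviation of
at least `m / k` at every exceptional state, where `k` is the actual number of visits, while the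
squared deviations sum to at most `m * δ`. -/
lemma exists_card_sampleLevel_lt_le (hp : ∀ x y, 0 ≤ p x y) (hs : ∀ x, ∑ y, p x y ≤ 1)
    (hU : U ⊆ W) {δ : ℝ} (hδ : 0 ≤ δ)
    (hsmall : ∀ x ∈ W, ∀ u ∈ U, x ≠ u → traceProb p W x u ≤ δ)
    {n : V → ℕ} {K : ℝ} (hK : ∑ v ∈ W, (n v : ℝ) ≤ K) (hW : W.Nonempty) {m : ℕ} (hm : 0 < m) :
    ∃ s : Sym W m,
      ((U.filter fun u => sampleLevel p W K s u < intensity p W n u).card : ℝ) ≤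
        K ^ 2 * δ / m := by
  have hk0 : 0 ≤ ∑ v ∈ W, (n v : ℝ) := Finset.sum_nonneg fun _ _ => Nat.cast_nonneg _
  have hm' : (0 : ℝ) < m := by exact_mod_cast hm
  rcases hk0.eq_or_lt with hk | hk
  · obtain ⟨w, hw⟩ := hW
    refine ⟨Sym.replicate m ⟨w, hw⟩, ?_⟩
    have h0 : ∀ u, intensity p W n u = 0 := fun u => by
      rw [intensity_eq_sum]
      refine Finset.sum_eq_zero fun v hv => ?_
      rw [(Finset.sum_eq_zero_iff_of_nonneg fun _ _ => Nat.cast_nonneg _).1 hk.symm v hv, zero_mul]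
    rw [Finset.filter_false_of_mem fun u _ => not_lt.2 ((h0 u).trans_le
      (sampleLevel_nonneg hp hs (hk0.trans hK) _ u))]
    simp only [Finset.card_empty, Nat.cast_zero]
    positivity
  · obtain ⟨s, hs'⟩ := exists_sym_sum_sq_le (U := U) hk (jumpProb_nonneg (W := W) hp hs) hδ
      (fun v hv u hu => by
        rw [jumpProb]
        split_ifs with h
        exacts [hsmall v hv u hu h.2, hδ])
      (sum_jumpProb_le_one hp hs hU) m
    refine ⟨s, ?_⟩
    set k := ∑ v ∈ W, (n v : ℝ) with hkdef
    set B := U.filter fun u => sampleLevel p W K s u < intensity p W n u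
    have hterm : ∀ u ∈ B, (m / k) ^ 2 ≤ (((s : Multiset W).map fun v : W => jumpProb p W v u).sum -
        m * ((∑ v ∈ W, n v * jumpProb p W v u) / k)) ^ 2 := by
      intro u hu
      have h1 := (Finset.mem_filter.1 hu).2
      rw [intensity_eq_sum, sampleLevel] at h1
      set S := ((s : Multiset W).map fun v : W => jumpProb p W v u).sum
      set L := ∑ v ∈ W, n v * jumpProb p W v u
      have hS : 0 ≤ S := by
        refine Multiset.sum_nonneg fun a ha => ?_
        obtain ⟨v, _, rfl⟩ := Multiset.mem_map.1 ha
        exact jumpProb_nonneg hp hs _ _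
      have h2 : k / m * S + 1 ≤ L :=
        le_trans (add_le_add_left (mul_le_mul_of_nonneg_right
          (div_le_div_of_nonneg_right hK hm'.le) hS) 1) h1.le
      have h3 : m / k ≤ m * (L / k) - S := by
        have := mul_le_mul_of_nonneg_left h2 (div_pos hm' hk).le
        have e1 : (m : ℝ) / k * (k / m * S + 1) = S + m / k := by field_simp
        have e2 : (m : ℝ) / k * L = m * (L / k) := by ring
        linarith
      have h4 : 0 ≤ (m : ℝ) / k := (div_pos hm' hk).le
      nlinarith
    have hsum : (B.card : ℝ) * (m / k) ^ 2 ≤ m * δ := by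
      rw [← nsmul_eq_mul]
      refine (Finset.card_nsmul_le_sum _ _ _ hterm).trans (le_trans ?_ hs')
      exact Finset.sum_le_sum_of_subset_of_nonneg (Finset.filter_subset _ _) fun _ _ _ => sq_nonneg _
    have h5 : (B.card : ℝ) ≤ k ^ 2 * δ / m := by
      rw [le_div_iff₀ hm']
      have e3 : (B.card : ℝ) * (m / k) ^ 2 * (k ^ 2 / m) = B.card * m := by field_simp
      have e4 : m * δ * (k ^ 2 / m) = k ^ 2 * δ := by field_simp
      have := mul_le_mul_of_nonneg_right hsum (by positivity : 0 ≤ k ^ 2 / m)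
      linarith
    refine h5.trans ?_
    gcongr

/-- Jensen's inequality, through the tangent of the exponential at level `C + 1`, which bounds the
average level over `U`. -/
lemma sum_exp_sampleLevel_ge (hp : ∀ x y, 0 ≤ p x y) (hs : ∀ x, ∑ y, p x y ≤ 1) (hU : U ⊆ W)
    {C : ℝ} (hC : 0 ≤ C) {m : ℕ} (hm : 0 < m) (s : Sym W m) :
    U.card * Real.exp (-2 * (C + 1)) ≤
      ∑ u ∈ U, Real.exp (-2 * sampleLevel p W (C * U.card) s u) := by
  have hm' : (0 : ℝ) < m := by exact_mod_cast hm
  have hsum : ∑ u ∈ U, sampleLevel p W (C * U.card) s u ≤ (C + 1) * U.card := by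
    simp only [sampleLevel]
    rw [Finset.sum_add_distrib, ← Finset.mul_sum, Finset.sum_const, nsmul_one]
    have h1 : ∑ u ∈ U, ((s : Multiset W).map fun v : W => jumpProb p W v u).sum ≤ m := by
      rw [← Multiset.sum_map_sum]
      refine (Multiset.sum_le_card_nsmul _ 1 fun a ha => ?_).trans_eq (by simp)
      obtain ⟨v, _, rfl⟩ := Multiset.mem_map.1 ha
      exact sum_jumpProb_le_one hp hs hU _
    have h2 : C * U.card / m * ∑ u ∈ U, ((s : Multiset W).map fun v : W => jumpProb p W v u).sum ≤
        C * U.card / m * m := mul_le_mul_of_nonneg_left h1 (by positivity)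
    rw [div_mul_cancel₀ _ hm'.ne'] at h2
    linarith
  calc (U.card : ℝ) * Real.exp (-2 * (C + 1))
      ≤ ∑ u ∈ U, Real.exp (-2 * (C + 1)) *
          (1 - 2 * (sampleLevel p W (C * U.card) s u - (C + 1))) := by
        rw [← Finset.mul_sum, Finset.sum_sub_distrib, ← Finset.mul_sum, Finset.sum_sub_distrib,
          Finset.sum_const, Finset.sum_const, nsmul_eq_mul, nsmul_eq_mul, mul_comm]
        refine mul_le_mul_of_nonneg_left ?_ (Real.exp_pos _).le
        linarith
    _ ≤ _ := by
        refine Finset.sum_le_sum fun u _ => ?_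
        have : -2 * sampleLevel p W (C * U.card) s u =
          -2 * (C + 1) + -2 * (sampleLevel p W (C * U.card) s u - (C + 1)) := by ring
        rw [this, Real.exp_add]
        refine mul_le_mul_of_nonneg_left ?_ (Real.exp_pos _).le
        linarith [Real.add_one_le_exp (-2 * (sampleLevel p W (C * U.card) s u - (C + 1)))]

/-- One term of the binomial expansion of `(x + 1) ^ N`, with `x` left free to be optimised. -/
lemma choose_le_exp (N m : ℕ) {x : ℝ} (hx : 0 < x) :
    (N.choose m : ℝ) ≤ Real.exp (m * Real.log (1 / x) + x * N) := by
  rcases le_or_gt m N with hm | hm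
  · have h1 : x ^ m * (N.choose m : ℝ) ≤ (x + 1) ^ N := by
      rw [add_pow]
      have := Finset.single_le_sum (f := fun k => x ^ k * 1 ^ (N - k) * (N.choose k : ℝ))
        (fun k _ => by positivity) (Finset.mem_range.2 (Nat.lt_succ_of_le hm))
      simpa using this
    have h2 : (x + 1) ^ N ≤ Real.exp (x * N) := by
      rw [mul_comm, Real.exp_nat_mul]
      exact pow_le_pow_left₀ (by positivity) (Real.add_one_le_exp x) N
    rw [Real.exp_add, Real.exp_nat_mul, Real.exp_log (by positivity), one_div, inv_pow,
      ← div_eq_inv_mul, le_div_iff₀ (by positivity), mul_comm]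
    exact h1.trans h2
  · rw [Nat.choose_eq_zero_of_lt hm]
    exact_mod_cast (Real.exp_pos _).le

/-- If all jump probabilities of the watched chain into `U` are small, then `U` is covered during
linearly many visits to `W` only with exponentially small probability. -/
theorem exists_measureReal_cover_le {C : ℝ} (hC : 1 ≤ C) :
    ∃ δ > 0, ∃ ε > 0, ∃ M > 0, ∀ {V : Type*} [Fintype V] [DecidableEq V] {Ω : Type*}
      [MeasurableSpace Ω] {p : V → V → ℝ} {W U : Finset V} {μ : Measure Ω}
      [IsProbabilityMeasure μ] {X : ℕ → Ω → V}, IsMarkovChain p μ X → (∀ x y, 0 ≤ p x y) →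
      (∀ x, ∑ y, p x y ≤ 1) → U ⊆ W → W.card ≤ 4 * U.card →
      (∀ x ∈ W, ∀ u ∈ U, x ≠ u → traceProb p W x u ≤ δ) → ∀ t : ℕ,
      μ.real {ω | (∀ u ∈ U, visits (fun i => X i ω) t u ≠ 0) ∧
        ∑ v ∈ W, (visits (fun i => X i ω) t v : ℝ) ≤ C * U.card} ≤
        M * Real.exp (-ε * U.card) := by
  -- `a` bounds the mean initial weight from below. The choice of `l` makes the visit term `l * a /
  -- 4` per state of `U`, and the allowed exceptions cost as much again, leaving the decay `l * a /
  -- 2 = 2 * γ`.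
  set a := Real.exp (-2 * (C + 1)) with ha
  have ha0 : 0 < a := Real.exp_pos _
  have ha1 : a ≤ 1 := Real.exp_le_one_iff.2 (by linarith)
  set l := a / (4 * C) with hl
  have hl0 : 0 < l := by positivity
  have hl1 : l ≤ 1 := (div_le_one (by positivity)).2 (by linarith)
  set γ := l * a / 4 with hγ
  have hγ0 : 0 < γ := by positivity
  have hγ1 : γ ≤ 1 := by rw [hγ]; nlinarith
  -- `x` and `ν` are chosen so that the number of samples grows only like `exp (γ / 2 * U.card)`;
  -- then `δ` is chosen so that at most `a / 4 * U.card` states are exceptional.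
  set x := γ / 16 with hx
  have hx0 : 0 < x := by positivity
  set Y := Real.log (1 / x) + x with hY
  have hlog : 0 ≤ Real.log (1 / x) := Real.log_nonneg ((le_div_iff₀ hx0).2 (by linarith))
  have hY0 : 0 < Y := by linarith
  set ν := γ / (4 * Y) with hν
  have hν0 : 0 < ν := by positivity
  refine ⟨min (1 / 2) (ν * a / (4 * C ^ 2)), by positivity, γ, hγ0, Real.exp (Y + l),
    Real.exp_pos _, ?_⟩
  intro V _ _ Ω _ p W U μ _ X hX hp hs hU hcard hsmall t
  set δ := min (1 / 2) (ν * a / (4 * C ^ 2)) with hδ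
  have hδ0 : 0 < δ := by positivity
  rcases U.eq_empty_or_nonempty with rfl | hne
  · simp only [Finset.card_empty, Nat.cast_zero, mul_zero, Real.exp_zero, mul_one]
    exact measureReal_le_one.trans (Real.one_le_exp (by linarith))
  have hUpos : (0 : ℝ) < U.card := by exact_mod_cast hne.card_pos
  set m := ⌈ν * U.card⌉₊ with hm
  have hm0 : 0 < m := Nat.ceil_pos.2 (by positivity)
  have hm' : (0 : ℝ) < m := by exact_mod_cast hm0
  have hm1 : ν * U.card ≤ m := Nat.le_ceil _
  have hm2 : (m : ℝ) ≤ ν * U.card + 1 := (Nat.ceil_lt_add_one (by positivity)).le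
  have hr : (C * U.card) ^ 2 * δ / m ≤ a / 4 * U.card := by
    rw [div_le_iff₀ hm']
    have h1 : C ^ 2 * δ ≤ ν * a / 4 := by
      have := mul_le_mul_of_nonneg_left (min_le_right (1 / 2) (ν * a / (4 * C ^ 2)))
        (sq_nonneg C)
      rw [← hδ] at this
      refine this.trans_eq ?_
      field_simp
    calc (C * U.card) ^ 2 * δ = C ^ 2 * δ * U.card ^ 2 := by ring
      _ ≤ ν * a / 4 * U.card ^ 2 := by gcongr
      _ = a / 4 * U.card * (ν * U.card) := by ring
      _ ≤ a / 4 * U.card * m := by gcongr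
  have hbound : ∀ s : Sym W m,
      μ.real {ω | (∀ u ∈ U, visits (fun i => X i ω) t u ≠ 0) ∧
        ∑ v ∈ W, (visits (fun i => X i ω) t v : ℝ) ≤ C * U.card ∧
        ((U.filter fun u => sampleLevel p W (C * U.card) s u <
          intensity p W (visits (fun i => X i ω) t) u).card : ℝ) ≤ a / 4 * U.card} ≤
      Real.exp (l - 2 * γ * U.card) := by
    intro s
    refine (hX.measureReal_cover_le hp hs hU
      (fun x hx u hu hxu => (hsmall x hx u hu hxu).trans (min_le_left _ _)) hl0.le hl1
      (sampleLevel_nonneg hp hs (by positivity) s) _ _ t).trans (Real.exp_le_exp.2 ?_)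
    have h1 := mul_le_mul_of_nonneg_left
      (sum_exp_sampleLevel_ge hp hs hU (by linarith : 0 ≤ C) hm0 s) hl0.le
    rw [← ha] at h1
    have h2 : l ^ 2 * (C * U.card) = l * a / 4 * U.card := by
      rw [hl]; field_simp
    rw [h2, hγ]
    linarith
  have hcount : (Fintype.card (Sym W m) : ℝ) ≤ Real.exp (Y + γ / 2 * U.card) := by
    rw [Sym.card_sym_eq_choose, Fintype.card_coe]
    refine (choose_le_exp _ m hx0).trans (Real.exp_le_exp.2 ?_)
    have h1 : ((W.card + m - 1 : ℕ) : ℝ) ≤ 4 * U.card + m := by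
      have : W.card + m - 1 ≤ 4 * U.card + m := by omega
      exact_mod_cast this
    have h2 := mul_le_mul_of_nonneg_left h1 hx0.le
    have h3 := mul_le_mul_of_nonneg_right hm2 hY0.le
    have h4 : ν * U.card * Y = γ / 4 * U.card := by rw [hν]; field_simp
    have h5 : x * 4 = γ / 4 := by rw [hx]; ring
    have h6 : m * Y = m * Real.log (1 / x) + x * m := by rw [hY]; ring
    have h7 : x * (4 * U.card + m) = γ / 4 * U.card + x * m := by rw [← h5]; ring
    linarith
  calc _ ≤ μ.real (⋃ s : Sym W m, {ω | (∀ u ∈ U, visits (fun i => X i ω) t u ≠ 0) ∧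
        ∑ v ∈ W, (visits (fun i => X i ω) t v : ℝ) ≤ C * U.card ∧
        ((U.filter fun u => sampleLevel p W (C * U.card) s u <
          intensity p W (visits (fun i => X i ω) t) u).card : ℝ) ≤ a / 4 * U.card}) := by
        refine measureReal_mono fun ω hω => ?_
        obtain ⟨s, hs'⟩ := exists_card_sampleLevel_lt_le hp hs hU hδ0.le hsmall hω.2
          (hne.mono hU) hm0
        exact Set.mem_iUnion.2 ⟨s, hω.1, hω.2, hs'.trans hr⟩
    _ ≤ ∑ s : Sym W m, Real.exp (l - 2 * γ * U.card) :=
        (measureReal_iUnion_fintype_le _).trans (Finset.sum_le_sum fun s _ => hbound s)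
    _ = Fintype.card (Sym W m) * Real.exp (l - 2 * γ * U.card) := by
        rw [Finset.sum_const, nsmul_eq_mul, Finset.card_univ]
    _ ≤ Real.exp (Y + γ / 2 * U.card) * Real.exp (l - 2 * γ * U.card) :=
        mul_le_mul_of_nonneg_right hcount (Real.exp_pos _).le
    _ ≤ _ := by
        rw [← Real.exp_add, ← Real.exp_add]
        refine Real.exp_le_exp.2 ?_
        have := mul_pos hγ0 hUpos
        linarith

end Sampling

/-! ### Colouring by an energy increment -/

section Partition

variable {V : Type*} [Fintype V] [DecidableEq V]

/-- A cut separating at least half of the points of `B` from their images under `f`. -/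
lemma exists_cut (B : Finset V) {f : V → V} (hf : ∀ v ∈ B, f v ≠ v) :
    ∃ c : V → Bool, B.card ≤ 2 * (B.filter fun v => c v ≠ c (f v)).card := by
  by_contra! hcon
  have half : ∀ v ∈ B, 2 * (Finset.univ.filter fun c : V → Bool => c v ≠ c (f v)).card =
      Fintype.card (V → Bool) := by
    intro v hv
    -- Changing the side of `v` alone pairs the cuts separating `v` from `f v` with the others, as
    -- `f v ≠ v`; averaging over all cuts follows.
    have hflip : (Finset.univ.filter fun c : V → Bool => c v ≠ c (f v)).card =
        (Finset.univ.filter fun c : V → Bool => ¬ c v ≠ c (f v)).card := by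
      refine Finset.card_bij' (fun c _ => Function.update c v (!c v))
        (fun c _ => Function.update c v (!c v)) ?_ ?_ ?_ ?_
      · intro c hc
        have h : c v ≠ c (f v) := (Finset.mem_filter.1 hc).2
        simpa [Function.update_of_ne (hf v hv), Bool.not_eq_eq_eq_not] using Bool.eq_not_of_ne h
      · intro c hc
        simpa [Function.update_of_ne (hf v hv)] using hc
      · intro c _; simp
      · intro c _; simp
    have := Finset.card_filter_add_card_filter_not (s := (Finset.univ : Finset (V → Bool)))
      (fun c => c v ≠ c (f v))
    rw [Finset.card_univ] at this
    omega
  have h1 : ∑ c : V → Bool, 2 * (B.filter fun v => c v ≠ c (f v)).card <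
      ∑ _c : V → Bool, B.card :=
    Finset.sum_lt_sum_of_nonempty Finset.univ_nonempty fun c _ => hcon c
  have h2 : ∑ c : V → Bool, 2 * (B.filter fun v => c v ≠ c (f v)).card =
      ∑ v ∈ B, 2 * (Finset.univ.filter fun c : V → Bool => c v ≠ c (f v)).card := by
    simp only [Finset.card_filter, Finset.mul_sum]
    exact Finset.sum_comm
  rw [h2, Finset.sum_congr rfl half, Finset.sum_const, Finset.sum_const, Finset.card_univ,
    smul_eq_mul, smul_eq_mul, mul_comm] at h1
  exact lt_irrefl _ h1

/-- The colour class of colour `j`. -/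
def colourClass (S : Finset V) (c : V → ℕ) (j : ℕ) : Finset V := S.filter fun v => c v = j

open scoped Classical in
/-- The states into which the chain watched on their colour class jumps with probability more than
`δ` from somewhere. -/
noncomputable def heavySet (p : V → V → ℝ) (S : Finset V) (δ : ℝ) (c : V → ℕ) : Finset V :=
  S.filter fun v => ∃ u ∈ colourClass S c (c v), u ≠ v ∧
    δ < traceProb p (colourClass S c (c v)) u v

variable {p : V → V → ℝ} {S : Finset V} {δ κ : ℝ}

/-- Each heavy state gets a partner that jumps to it with probability above `δ`, and one cut
separates at least half of these pairs. A separated state gains `κ` in return probability; no other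
state of `S` loses any, since classes only shrink. -/
lemma exists_refinement (hp : ∀ x y, 0 ≤ p x y) (hs : ∀ x, ∑ y, p x y ≤ 1) (hκ : 0 ≤ κ)
    (hback : ∀ W ⊆ S, ∀ u ∈ W, ∀ v ∈ W, δ < traceProb p W u v →
      κ ≤ traceProb p W v u * traceProb p W u v)
    {c : V → ℕ} {k : ℕ} (hc : ∀ v, c v < k) :
    ∃ c' : V → ℕ, (∀ v, c' v < 2 * k) ∧
      ∑ v ∈ S, traceProb p (colourClass S c (c v)) v v + κ * (heavySet p S δ c).card / 2 ≤
        ∑ v ∈ S, traceProb p (colourClass S c' (c' v)) v v := by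
  classical
  have hpartner : ∀ v, ∃ u, v ∈ heavySet p S δ c → u ∈ colourClass S c (c v) ∧ u ≠ v ∧
      δ < traceProb p (colourClass S c (c v)) u v := by
    intro v
    by_cases hv : v ∈ heavySet p S δ c
    · obtain ⟨u, h1, h2⟩ := (Finset.mem_filter.1 hv).2
      exact ⟨u, fun _ => ⟨h1, h2⟩⟩
    · exact ⟨v, fun h => absurd h hv⟩
  choose f hf using hpartner
  obtain ⟨A, hA⟩ := exists_cut (heavySet p S δ c) (f := f) fun v hv => (hf v hv).2.1
  set c' : V → ℕ := fun v => 2 * c v + (A v).toNat with hc'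
  have hb : ∀ v, (A v).toNat ≤ 1 := fun v => Bool.toNat_le _
  refine ⟨c', fun v => by have := hc v; have := hb v; simp only [hc']; omega, ?_⟩
  have hsub : ∀ v, colourClass S c' (c' v) ⊆ colourClass S c (c v) := by
    intro v u hu
    simp only [colourClass, Finset.mem_filter, hc'] at hu ⊢
    have := hb u; have := hb v
    exact ⟨hu.1, by omega⟩
  have hmem : ∀ v ∈ S, v ∈ colourClass S c' (c' v) := fun v hv =>
    Finset.mem_filter.2 ⟨hv, rfl⟩
  set B := (heavySet p S δ c).filter fun v => A v ≠ A (f v) with hB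
  have hBS : B ⊆ S := (Finset.filter_subset _ _).trans (Finset.filter_subset _ _)
  have hpoint : ∀ v ∈ S, traceProb p (colourClass S c (c v)) v v + (if v ∈ B then κ else 0) ≤
      traceProb p (colourClass S c' (c' v)) v v := by
    intro v hv
    split_ifs with hvB
    · obtain ⟨hv1, hv2⟩ := Finset.mem_filter.1 hvB
      obtain ⟨h1, -, h3⟩ := hf v hv1
      have h4 : f v ∉ colourClass S c' (c' v) := by
        intro h
        have h5 := (Finset.mem_filter.1 h).2
        have h6 := (Finset.mem_filter.1 h1).2
        simp only [hc', h6] at h5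
        exact hv2 (by cases hA1 : A v <;> cases hA2 : A (f v) <;> simp_all)
      refine le_trans ?_ (traceProb_self_add_le hp hs (hsub v) (hmem v hv) h1 h4)
      exact add_le_add_right (hback _ (Finset.filter_subset _ _) _ h1 _ (hsub v (hmem v hv)) h3) _
    · rw [add_zero]
      exact traceProb_le_of_subset hp hs (hsub v) v (hmem v hv)
  refine le_trans ?_ (Finset.sum_le_sum hpoint)
  rw [Finset.sum_add_distrib, Finset.sum_ite_mem, Finset.inter_eq_right.2 hBS, Finset.sum_const,
    nsmul_eq_mul]
  have h7 : ((heavySet p S δ c).card : ℝ) ≤ 2 * B.card := by exact_mod_cast hA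
  have := mul_le_mul_of_nonneg_left h7 hκ
  linarith

/-- A set on which watched chains always have reasonably likely back-jumps can be divided into
boundedly many classes, for most of whose states no jump into them is likely. -/
lemma exists_colouring (hp : ∀ x y, 0 ≤ p x y) (hs : ∀ x, ∑ y, p x y ≤ 1) (hκ : 0 < κ)
    (hback : ∀ W ⊆ S, ∀ u ∈ W, ∀ v ∈ W, δ < traceProb p W u v →
      κ ≤ traceProb p W v u * traceProb p W u v)
    {s : ℕ} (hsκ : 8 < s * κ) :
    ∃ c : V → ℕ, (∀ v, c v < 2 ^ s) ∧ 4 * (heavySet p S δ c).card ≤ S.card := by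
  -- If more than a quarter of `S` stays heavy, each refinement adds at least `κ / 8 * S.card` to
  -- the sum of return probabilities, which never exceeds `S.card`.
  by_contra! hcon
  have key : ∀ i ≤ s, ∃ c : V → ℕ, (∀ v, c v < 2 ^ i) ∧
      i * κ / 8 * S.card ≤ ∑ v ∈ S, traceProb p (colourClass S c (c v)) v v := by
    intro i
    induction i with
    | zero =>
      refine fun _ => ⟨fun _ => 0, by simp, ?_⟩
      simpa using Finset.sum_nonneg fun v _ => traceProb_nonneg hp hs v v
    | succ i ih =>
      intro hi
      obtain ⟨c, hc, hle⟩ := ih (by omega)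
      obtain ⟨c', hc', hle'⟩ := exists_refinement hp hs hκ.le hback hc
      refine ⟨c', fun v => by rw [pow_succ, mul_comm]; exact hc' v, ?_⟩
      have h1 : (S.card : ℝ) ≤ 4 * (heavySet p S δ c).card := by
        exact_mod_cast (hcon c fun v => (hc v).trans_le
          (Nat.pow_le_pow_right (by norm_num) (by omega))).le
      have := mul_le_mul_of_nonneg_left h1 hκ.le
      push_cast
      linarith
  obtain ⟨c, hc, hle⟩ := key s le_rfl
  have h1 : ∑ v ∈ S, traceProb p (colourClass S c (c v)) v v ≤ S.card := by
    refine (Finset.sum_le_card_nsmul _ _ 1 fun v hv => traceProb_le_one hp hs v ?_).trans_eq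
      (by simp)
    exact Finset.mem_filter.2 ⟨hv, rfl⟩
  have h2 : 0 < S.card := by
    by_contra h
    have h3 : S = ∅ := Finset.card_eq_zero.1 (by omega)
    have := hcon c hc
    simp [h3, heavySet] at this
  have h4 : (0 : ℝ) < S.card := by exact_mod_cast h2
  nlinarith

end Partition

/-! ### Simple random walk: few or many vertices of low degree -/

section RandomWalk

lemma sum_ite_mem_zero_one {V : Type*} [DecidableEq V] (T H : Finset V) :
    ∑ v ∈ T, (if v ∈ H then (0 : ℝ) else 1) = ((T \ H).card : ℝ) := by
  rw [← Finset.filter_notMem_eq_sdiff, Finset.card_filter, Nat.cast_sum]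
  exact Finset.sum_congr rfl fun v _ => by by_cases h : v ∈ H <;> simp [h]

variable {V Ω : Type*} [Fintype V] [MeasurableSpace Ω] (G : SimpleGraph V) [DecidableRel G.Adj]

lemma walkProb_nonneg (x y : V) : 0 ≤ walkProb G x y := by
  rw [walkProb]
  split_ifs <;> positivity

lemma sum_walkProb (x : V) : ∑ y, walkProb G x y = G.degree x * (1 / G.degree x) := by
  simp only [walkProb]
  rw [← Finset.sum_filter, Finset.sum_const, nsmul_eq_mul, ← SimpleGraph.card_neighborFinset_eq_degree,
    SimpleGraph.neighborFinset_eq_filter]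

lemma sum_walkProb_le_one (x : V) : ∑ y, walkProb G x y ≤ 1 := by
  rw [sum_walkProb, one_div]
  exact mul_inv_le_one

lemma degree_pos_of_adj {G : SimpleGraph V} [DecidableRel G.Adj] {x y : V} (h : G.Adj x y) :
    0 < G.degree x := (G.degree_pos_iff_exists_adj x).2 ⟨y, h⟩

lemma degree_mul_walkProb (x y : V) :
    (G.degree x : ℝ) * walkProb G x y = if G.Adj x y then 1 else 0 := by
  rw [walkProb]
  split_ifs with h
  · have : (G.degree x : ℝ) ≠ 0 := by exact_mod_cast (degree_pos_of_adj h).ne'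
    field_simp
  · simp

lemma walkProb_reversible (x y : V) :
    (G.degree x : ℝ) * walkProb G x y = G.degree y * walkProb G y x := by
  rw [degree_mul_walkProb, degree_mul_walkProb]
  simp only [G.adj_comm]

variable [DecidableEq V]

/-- Reversibility with respect to the degrees: `u` has degree at least one, since it is left with
positive probability, and `v` has degree at most `D`, so the reverse jump has probability at least
`δ / D`. -/
lemma le_traceProb_mul_traceProb {D : ℕ} {δ : ℝ} (hδ : 0 ≤ δ) {W : Finset V}
    (hW : ∀ v ∈ W, G.degree v ≤ D) {u v : V} (hu : u ∈ W) (hv : v ∈ W)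
    (h : δ < traceProb (walkProb G) W u v) :
    δ ^ 2 / D ≤ traceProb (walkProb G) W v u * traceProb (walkProb G) W u v := by
  have hp := walkProb_nonneg G
  have hs := sum_walkProb_le_one G
  have hrev := traceProb_reversible hp hs (walkProb_reversible G) hv hu
  have hdu : (1 : ℝ) ≤ G.degree u := by
    by_contra hcon
    have h0 : G.degree u = 0 := by
      by_contra h1
      exact hcon (by exact_mod_cast Nat.one_le_iff_ne_zero.2 h1)
    have : traceProb (walkProb G) W u v = 0 := by
      refine Finset.sum_eq_zero fun y _ => ?_
      rw [walkProb, if_neg fun hadj => (degree_pos_of_adj hadj).ne' h0, zero_mul]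
    linarith
  have hdv : (G.degree v : ℝ) ≤ D := by exact_mod_cast hW v hv
  have hq := traceProb_nonneg (W := W) hp hs v u
  have h1 : δ ≤ D * traceProb (walkProb G) W v u := by
    calc δ ≤ 1 * traceProb (walkProb G) W u v := by linarith
      _ ≤ G.degree u * traceProb (walkProb G) W u v := by gcongr; linarith
      _ = G.degree v * traceProb (walkProb G) W v u := hrev
      _ ≤ _ := by gcongr
  have hD : (0 : ℝ) < D := by
    have : (G.degree u : ℝ) ≤ D := by exact_mod_cast hW u hu
    linarith
  rw [div_le_iff₀ hD]
  nlinarith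

/-- Covering is unlikely when most states have only neighbours of large degree. -/
lemma exists_cover_le_of_few_low {C : ℝ} (hC : 1 ≤ C) :
    ∃ D : ℕ, 0 < D ∧ ∃ ε > 0, ∃ M > 0, ∀ {V : Type*} [Fintype V] [DecidableEq V] {Ω : Type*}
      [MeasurableSpace Ω] (G : SimpleGraph V) [DecidableRel G.Adj] {μ : Measure Ω}
      [IsProbabilityMeasure μ] {X : ℕ → Ω → V}, IsRandomWalk G μ X →
      2 * D * (Finset.univ.filter fun v => G.degree v ≤ D).card ≤ Fintype.card V →
      ∀ t : ℕ, t ≤ C * Fintype.card V →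
      μ.real {ω | ∀ v, visits (fun i => X i ω) t v ≠ 0} ≤ M * Real.exp (-ε * Fintype.card V) := by
  -- The constant doubles because `U` is only guaranteed to contain half of the vertices.
  obtain ⟨δ, hδ, ε, hε, M, hM, key⟩ := exists_measureReal_cover_le (C := 2 * C) (by linarith)
  refine ⟨⌈1 / δ⌉₊, Nat.ceil_pos.2 (by positivity), ε / 2, by positivity, M, hM, ?_⟩
  intro V _ _ Ω _ G _ μ _ X hX hlow t ht
  set D := ⌈1 / δ⌉₊ with hD
  have hDδ : 1 / δ ≤ D := Nat.le_ceil _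
  set S := Finset.univ.filter fun v => G.degree v ≤ D with hS
  set U := Finset.univ.filter fun u => ∀ v, G.Adj v u → D < G.degree v with hU
  -- Every vertex outside `U` neighbours a low-degree one, so there are at most `D * S.card` of
  -- them.
  have hcompl : Uᶜ ⊆ S.biUnion fun v => G.neighborFinset v := by
    intro u hu
    simp only [hU, Finset.mem_compl, Finset.mem_filter, Finset.mem_univ, true_and, not_forall,
      not_lt] at hu
    obtain ⟨v, hadj, hv⟩ := hu
    exact Finset.mem_biUnion.2 ⟨v, Finset.mem_filter.2 ⟨Finset.mem_univ _, hv⟩, by simpa using hadj⟩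
  have hcard : Fintype.card V ≤ 2 * U.card := by
    have h1 : Uᶜ.card ≤ S.card * D := (Finset.card_le_card hcompl).trans
      (Finset.card_biUnion_le_card_mul _ _ _ fun v hv => by
        rw [SimpleGraph.card_neighborFinset_eq_degree]; exact (Finset.mem_filter.1 hv).2)
    have h2 := Finset.card_add_card_compl U
    have h3 : 2 * D * S.card = 2 * (S.card * D) := by ring
    omega
  have hcard' : (Fintype.card V : ℝ) ≤ 2 * U.card := by exact_mod_cast hcard
  have := key (p := walkProb G) (W := Finset.univ) (U := U) hX (walkProb_nonneg G)
    (sum_walkProb_le_one G) (Finset.subset_univ _) (by rw [Finset.card_univ]; omega)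
    (fun x _ u hu _ => by
      rw [traceProb_univ (walkProb_nonneg G) (sum_walkProb_le_one G), walkProb]
      split_ifs with hadj
      · have h4 : (D : ℝ) < G.degree x := by exact_mod_cast (Finset.mem_filter.1 hu).2 x hadj
        rw [one_div_le (lt_of_le_of_lt (Nat.cast_nonneg _) h4) hδ]
        linarith
      · exact hδ.le) t
  refine (measureReal_mono fun ω hω => ?_).trans (this.trans ?_)
  · refine ⟨fun u _ => hω u, ?_⟩
    have h5 : ∑ v, (visits (fun i => X i ω) t v : ℝ) = t := by
      exact_mod_cast sum_visits (fun i => X i ω) t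
    rw [h5]
    nlinarith
  · gcongr M * Real.exp ?_
    nlinarith

/-- Covering is unlikely when a positive proportion of the states has bounded degree. -/
lemma exists_cover_le_of_many_low {C : ℝ} (hC : 1 ≤ C) {D : ℕ} (hD : 0 < D) :
    ∃ ε > 0, ∃ M > 0, ∀ {V : Type*} [Fintype V] [DecidableEq V] {Ω : Type*}
      [MeasurableSpace Ω] (G : SimpleGraph V) [DecidableRel G.Adj] {μ : Measure Ω}
      [IsProbabilityMeasure μ] {X : ℕ → Ω → V}, IsRandomWalk G μ X →
      Fintype.card V ≤ 2 * D * (Finset.univ.filter fun v => G.degree v ≤ D).card →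
      ∀ t : ℕ, t ≤ C * Fintype.card V →
      μ.real {ω | ∀ v, visits (fun i => X i ω) t v ≠ 0} ≤ M * Real.exp (-ε * Fintype.card V) := by
  have hD' : (1 : ℝ) ≤ D := by exact_mod_cast hD
  obtain ⟨δ, hδ, ε, hε, M, hM, key⟩ := exists_measureReal_cover_le (C := 16 * D * C) (by nlinarith)
  obtain ⟨s, hs⟩ := exists_nat_gt (8 / (δ ^ 2 / D))
  have hκ : 0 < δ ^ 2 / (D : ℝ) := by positivity
  rw [div_lt_iff₀ hκ] at hs
  refine ⟨ε / (8 * D * 2 ^ s), by positivity, 2 ^ s * M, by positivity, ?_⟩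
  intro V _ _ Ω _ G _ μ _ X hX hlow t ht
  have hV : Nonempty V := by
    obtain ⟨ω⟩ := nonempty_of_isProbabilityMeasure μ
    exact ⟨X 0 ω⟩
  have hp := walkProb_nonneg G
  have hs1 := sum_walkProb_le_one G
  set S := Finset.univ.filter fun v => G.degree v ≤ D with hS
  have hlow' : (Fintype.card V : ℝ) ≤ 2 * D * S.card := by exact_mod_cast hlow
  have hVpos : (0 : ℝ) < Fintype.card V := by exact_mod_cast Fintype.card_pos
  obtain ⟨c, hc, hheavy⟩ := exists_colouring (S := S) (δ := δ) hp hs1 hκ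
    (fun W hW u hu v hv h => le_traceProb_mul_traceProb G hδ.le
      (fun v hv => (Finset.mem_filter.1 (hW hv)).2) hu hv h) hs
  set W := fun j => colourClass S c j with hW
  set U := fun j => W j \ heavySet (walkProb G) S δ c with hU
  have hsmall : ∀ j, ∀ x ∈ W j, ∀ u ∈ U j, x ≠ u → traceProb (walkProb G) (W j) x u ≤ δ := by
    intro j x hx u hu hxu
    obtain ⟨hu1, hu2⟩ := Finset.mem_sdiff.1 hu
    obtain ⟨huS, rfl⟩ := Finset.mem_filter.1 hu1
    by_contra! hcon
    exact hu2 (Finset.mem_filter.2 ⟨huS, x, hx, hxu, hcon⟩)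
  -- The classes that are large and mostly not heavy.
  set J := (Finset.range (2 ^ s)).filter fun j =>
    (W j).card ≤ 4 * (U j).card ∧ S.card ≤ 4 * 2 ^ s * (U j).card with hJ
  have hWsum : ∀ g : V → ℝ, ∑ j ∈ Finset.range (2 ^ s), ∑ v ∈ W j, g v = ∑ v ∈ S, g v := fun g =>
    Finset.sum_fiberwise_of_maps_to (fun v _ => Finset.mem_range.2 (hc v)) g
  have hWcard : ∑ j ∈ Finset.range (2 ^ s), ((W j).card : ℝ) = S.card := by
    simpa using hWsum fun _ => 1
  have hUcard : 3 / 4 * (S.card : ℝ) ≤ ∑ j ∈ Finset.range (2 ^ s), ((U j).card : ℝ) := by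
    have h1 := hWsum fun v => if v ∈ heavySet (walkProb G) S δ c then 0 else 1
    have h2 : ∀ T : Finset V, ∑ v ∈ T, (if v ∈ heavySet (walkProb G) S δ c then (0 : ℝ) else 1) =
        ((T \ heavySet (walkProb G) S δ c).card : ℝ) := fun T =>
      sum_ite_mem_zero_one T _
    have h6 : ∑ j ∈ Finset.range (2 ^ s), ((U j).card : ℝ) =
        ((S \ heavySet (walkProb G) S δ c).card : ℝ) := by
      rw [← h2 S, ← h1]
      exact Finset.sum_congr rfl fun j _ => (h2 (W j)).symm
    rw [h6]
    have h3 := Finset.le_card_sdiff (heavySet (walkProb G) S δ c) S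
    have h4 : 3 * S.card ≤ 4 * (S \ heavySet (walkProb G) S δ c).card := by omega
    have h5 : (3 : ℝ) * S.card ≤ 4 * (S \ heavySet (walkProb G) S δ c).card := by exact_mod_cast h4
    linarith
  -- Pigeonhole: otherwise mostly heavy classes, small classes and overvisited classes would
  -- contribute at most `1/4`, `1/4` and `1/8` of `S.card` to the sum of the `(U j).card`, which is
  -- at least `3/4` of it. The factor `16 * D * C` is what gives the `1/8`.
  have hcover : {ω | ∀ v, visits (fun i => X i ω) t v ≠ 0} ⊆
      ⋃ j ∈ J, {ω | (∀ u ∈ U j, visits (fun i => X i ω) t u ≠ 0) ∧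
        ∑ v ∈ W j, (visits (fun i => X i ω) t v : ℝ) ≤ 16 * D * C * (U j).card} := by
    intro ω hω
    by_contra hcon
    simp only [Set.mem_iUnion, Set.mem_ofPred_eq, exists_prop, not_exists, not_and, not_le] at hcon
    set n := visits (fun i => X i ω) t with hn
    have hDC : 0 < 16 * (D : ℝ) * C := by positivity
    have h1 : ∀ j ∈ Finset.range (2 ^ s), ((U j).card : ℝ) ≤ (W j).card / 4 +
        S.card / (4 * 2 ^ s) + (∑ v ∈ W j, (n v : ℝ)) / (16 * D * C) := by
      intro j hj
      have e1 : (0 : ℝ) ≤ (W j).card / 4 := by positivity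
      have e2 : (0 : ℝ) ≤ S.card / (4 * 2 ^ s) := by positivity
      have e3 : (0 : ℝ) ≤ (∑ v ∈ W j, (n v : ℝ)) / (16 * D * C) := by positivity
      by_cases h2 : (W j).card ≤ 4 * (U j).card
      · by_cases h3 : S.card ≤ 4 * 2 ^ s * (U j).card
        · have h4 := hcon j (Finset.mem_filter.2 ⟨hj, h2, h3⟩) fun u _ => hω u
          have h5 : ((U j).card : ℝ) ≤ (∑ v ∈ W j, (n v : ℝ)) / (16 * D * C) := by
            rw [le_div_iff₀ hDC]; linarith
          linarith
        · have h4 : (4 * 2 ^ s * (U j).card : ℝ) ≤ S.card := by exact_mod_cast (not_le.1 h3).le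
          have h5 : ((U j).card : ℝ) ≤ S.card / (4 * 2 ^ s) := by
            rw [le_div_iff₀ (by positivity)]; linarith
          linarith
      · have h4 : (4 * (U j).card : ℝ) ≤ (W j).card := by exact_mod_cast (not_le.1 h2).le
        linarith
    have h2 := hUcard.trans (Finset.sum_le_sum h1)
    rw [Finset.sum_add_distrib, Finset.sum_add_distrib, Finset.sum_const, Finset.card_range,
      nsmul_eq_mul, ← Finset.sum_div, ← Finset.sum_div, hWcard, hWsum fun v => (n v : ℝ)] at h2
    have h3 : ((2 ^ s : ℕ) : ℝ) * (S.card / (4 * 2 ^ s)) = S.card / 4 := by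
      push_cast; field_simp
    have h4 : ∑ v ∈ S, (n v : ℝ) ≤ C * Fintype.card V := by
      refine le_trans ?_ ht
      calc ∑ v ∈ S, (n v : ℝ) ≤ ∑ v, (n v : ℝ) :=
            Finset.sum_le_sum_of_subset_of_nonneg (Finset.subset_univ _) fun _ _ _ => by positivity
        _ = t := by exact_mod_cast sum_visits (fun i => X i ω) t
    have h5 : (∑ v ∈ S, (n v : ℝ)) / (16 * D * C) ≤ S.card / 8 := by
      rw [div_le_iff₀ hDC]
      have := mul_le_mul_of_nonneg_left hlow' (by linarith : 0 ≤ C)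
      nlinarith
    have h6 : (0 : ℝ) < S.card := by
      by_contra h
      have : (S.card : ℝ) = 0 := le_antisymm (not_lt.1 h) (Nat.cast_nonneg _)
      rw [this] at hlow'
      linarith
    rw [h3] at h2
    linarith
  calc μ.real {ω | ∀ v, visits (fun i => X i ω) t v ≠ 0}
      ≤ μ.real (⋃ j ∈ J, {ω | (∀ u ∈ U j, visits (fun i => X i ω) t u ≠ 0) ∧
        ∑ v ∈ W j, (visits (fun i => X i ω) t v : ℝ) ≤ 16 * D * C * (U j).card}) :=
        measureReal_mono hcover (measure_ne_top μ _)
    _ ≤ ∑ j ∈ J, μ.real {ω | (∀ u ∈ U j, visits (fun i => X i ω) t u ≠ 0) ∧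
        ∑ v ∈ W j, (visits (fun i => X i ω) t v : ℝ) ≤ 16 * D * C * (U j).card} :=
        measureReal_biUnion_finset_le _ _
    _ ≤ ∑ j ∈ J, M * Real.exp (-(ε / (8 * D * 2 ^ s)) * Fintype.card V) := by
        refine Finset.sum_le_sum fun j hj => ?_
        obtain ⟨-, hj1, hj2⟩ := Finset.mem_filter.1 hj
        refine (key hX hp hs1 Finset.sdiff_subset hj1 (hsmall j) t).trans ?_
        gcongr M * Real.exp ?_
        have h1 : (S.card : ℝ) ≤ 4 * 2 ^ s * (U j).card := by exact_mod_cast hj2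
        have h2 : (Fintype.card V : ℝ) ≤ 8 * D * 2 ^ s * (U j).card := by nlinarith
        rw [neg_mul, neg_mul, neg_le_neg_iff, div_mul_eq_mul_div, div_le_iff₀ (by positivity)]
        nlinarith
    _ ≤ 2 ^ s * M * Real.exp (-(ε / (8 * D * 2 ^ s)) * Fintype.card V) := by
        rw [Finset.sum_const, nsmul_eq_mul, ← mul_assoc]
        have h1 : (J.card : ℝ) ≤ 2 ^ s := by
          have := Finset.card_filter_le (Finset.range (2 ^ s)) fun j =>
            (W j).card ≤ 4 * (U j).card ∧ S.card ≤ 4 * 2 ^ s * (U j).card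
          rw [Finset.card_range] at this
          exact_mod_cast this
        gcongr

end RandomWalk

/-! ### The combined bound and graphs of bounded size -/

section CoverTime

lemma visits_ne_zero_iff {V : Type*} [DecidableEq V] {x : ℕ → V} {t : ℕ} {v : V} :
    visits x t v ≠ 0 ↔ ∃ i < t, x i = v := by
  simp [visits, Finset.card_eq_zero, Finset.filter_eq_empty_iff]

/-- The exponential bound, up to a constant factor. -/
lemma exists_cover_le {C : ℝ} (hC : 1 ≤ C) :
    ∃ ε > 0, ∃ M > 0, ∀ {V : Type*} [Fintype V] [DecidableEq V] {Ω : Type*}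
      [MeasurableSpace Ω] (G : SimpleGraph V) [DecidableRel G.Adj] {μ : Measure Ω}
      [IsProbabilityMeasure μ] {X : ℕ → Ω → V}, IsRandomWalk G μ X →
      ∀ t : ℕ, t ≤ C * Fintype.card V →
      μ.real {ω | ∀ v, visits (fun i => X i ω) t v ≠ 0} ≤ M * Real.exp (-ε * Fintype.card V) := by
  obtain ⟨D, hD, ε₁, hε₁, M₁, hM₁, few⟩ := exists_cover_le_of_few_low hC
  obtain ⟨ε₂, hε₂, M₂, hM₂, many⟩ := exists_cover_le_of_many_low hC hD
  refine ⟨min ε₁ ε₂, lt_min hε₁ hε₂, max M₁ M₂, lt_max_of_lt_left hM₁, ?_⟩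
  intro V _ _ Ω _ G _ μ _ X hX t ht
  rcases le_total (2 * D * (Finset.univ.filter fun v => G.degree v ≤ D).card) (Fintype.card V)
    with h | h
  · refine (few G hX h t ht).trans ?_
    gcongr
    exacts [le_max_left _ _, min_le_left _ _]
  · refine (many G hX h t ht).trans ?_
    gcongr
    exacts [le_max_right _ _, min_le_right _ _]

variable {V Ω : Type*} [Fintype V] [MeasurableSpace Ω] {G : SimpleGraph V} [DecidableRel G.Adj]
  {μ : Measure Ω} [IsProbabilityMeasure μ] {X : ℕ → Ω → V}

/-- From an isolated vertex all transition probabilities are zero, so the Markov property at time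
`0` rules out starting there with positive probability. -/
lemma IsRandomWalk.exists_adj (hX : IsRandomWalk G μ X) {v : V} (hv : 0 < μ.real {ω | X 0 ω = v}) :
    ∃ w, G.Adj v w := by
  by_contra! hcon
  refine absurd hv (not_lt.2 ?_)
  set x : V → ℕ → V := fun w i => if i = 0 then v else w with hx
  calc μ.real {ω | X 0 ω = v} ≤ μ.real (⋃ w, {ω | ∀ i ≤ 0 + 1, X i ω = x w i}) := by
        refine measureReal_mono fun ω hω => Set.mem_iUnion.2 ⟨X 1 ω, fun i hi => ?_⟩
        have hω' : X 0 ω = v := hω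
        interval_cases i <;> simp [hx, hω']
    _ ≤ ∑ w, μ.real {ω | ∀ i ≤ 0 + 1, X i ω = x w i} := measureReal_iUnion_fintype_le _
    _ = 0 := by
        refine Finset.sum_eq_zero fun w _ => ?_
        rw [IsMarkovChain.markov hX 0 (x w)]
        simp [hx, walkProb, hcon w]

/-- The walk may oscillate along a single edge. -/
lemma IsRandomWalk.exists_oscillation_le (hX : IsRandomWalk G μ X) (t : ℕ) :
    ∃ v w : V, (1 / (Fintype.card V : ℝ)) ^ (t + 1) ≤
      μ.real {ω | ∀ i ≤ t, X i ω = if Even i then v else w} := by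
  have hV : Nonempty V := by
    obtain ⟨ω⟩ := nonempty_of_isProbabilityMeasure μ
    exact ⟨X 0 ω⟩
  have hVpos : (0 : ℝ) < Fintype.card V := by exact_mod_cast Fintype.card_pos
  -- Some starting vertex has at least average probability, and each step along an edge has
  -- probability at least `1 / Fintype.card V`.
  obtain ⟨v, -, hv⟩ : ∃ v ∈ Finset.univ, 1 / (Fintype.card V : ℝ) ≤ μ.real {ω | X 0 ω = v} := by
    refine Finset.exists_le_of_sum_le Finset.univ_nonempty ?_
    rw [IsMarkovChain.sum_measureReal_eq_one hX, Finset.sum_const, Finset.card_univ, nsmul_eq_mul,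
      mul_one_div_cancel hVpos.ne']
  obtain ⟨w, hw⟩ := hX.exists_adj (lt_of_lt_of_le (by positivity) hv)
  refine ⟨v, w, ?_⟩
  induction t with
  | zero => simpa using hv
  | succ t ih =>
    rw [IsMarkovChain.markov hX t fun i => if Even i then v else w, pow_succ]
    have hdeg : ∀ a b, G.Adj a b → 1 / (Fintype.card V : ℝ) ≤ walkProb G a b := by
      intro a b hab
      rw [walkProb, if_pos hab]
      have h1 : (0 : ℝ) < G.degree a := by exact_mod_cast degree_pos_of_adj hab
      have h2 : (G.degree a : ℝ) ≤ Fintype.card V := by exact_mod_cast (G.degree_lt_card_verts a).le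
      exact one_div_le_one_div_of_le h1 h2
    refine mul_le_mul ih ?_ (by positivity) measureReal_nonneg
    by_cases ht : Even t
    · simpa [ht, Nat.even_add_one] using hdeg v w hw
    · simpa [ht, Nat.even_add_one] using hdeg w v hw.symm

/-- An oscillating walk sees at most two vertices, so with three or more it cannot cover. -/
lemma IsRandomWalk.cover_le_one_sub [DecidableEq V] (hX : IsRandomWalk G μ X)
    (hV : 3 ≤ Fintype.card V) (t : ℕ) :
    μ.real {ω | ∀ v, visits (fun i => X i ω) t v ≠ 0} ≤
      1 - (1 / (Fintype.card V : ℝ)) ^ (t + 1) := by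
  obtain ⟨v, w, hvw⟩ := hX.exists_oscillation_le t
  obtain ⟨u, hu⟩ : ∃ u, u ∉ ({v, w} : Finset V) := by
    by_contra! h
    have h1 := Finset.card_le_card (fun u _ => h u : Finset.univ ⊆ ({v, w} : Finset V))
    have h2 : ({v, w} : Finset V).card ≤ 2 := Finset.card_le_two
    rw [Finset.card_univ] at h1
    omega
  simp only [Finset.mem_insert, Finset.mem_singleton, not_or] at hu
  have hmeas : MeasurableSet {ω | ∀ i ≤ t, X i ω = if Even i then v else w} := by
    have : {ω | ∀ i ≤ t, X i ω = if Even i then v else w} =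
        ⋂ i ∈ Set.Iic t, {ω | X i ω = if Even i then v else w} := by
      ext ω; simp
    rw [this]
    exact MeasurableSet.biInter (Set.to_countable _) fun i _ =>
      IsMarkovChain.measurableSet_eq hX i _
  have := probReal_compl_eq_one_sub (μ := μ) hmeas
  refine le_trans (measureReal_mono ?_) (this.le.trans (sub_le_sub_left hvw 1))
  intro ω hω hω'
  obtain ⟨i, hi, hiu⟩ := visits_ne_zero_iff.1 (hω u)
  have h3 := hω' i hi.le
  rw [hiu] at h3
  split_ifs at h3
  exacts [hu.1 h3, hu.2 h3]

end CoverTime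

theorem theorem1p1 (C : ℝ) :
    ∃ ε : ℝ, 0 < ε ∧
      ∀ (V : Type*) [Fintype V] (G : SimpleGraph V) [DecidableRel G.Adj]
        (Ω : Type*) [MeasurableSpace Ω] (μ : Measure Ω) [IsProbabilityMeasure μ]
        (X : ℕ → Ω → V),
        3 ≤ Fintype.card V → IsRandomWalk G μ X →
          μ.real {ω | (fun t : ℕ => X t ω) '' {t : ℕ | (t : ℝ) ≤ C * Fintype.card V} = Set.univ} <
            Real.exp (-ε * Fintype.card V) := by
  -- Enlarging `C` only enlarges the event, so small and negative `C` need no separate treatment.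
  set C₀ := max C 1 with hC₀
  have hC1 : 1 ≤ C₀ := le_max_right _ _
  obtain ⟨ε, hε, M, hM, key⟩ := exists_cover_le (C := 2 * C₀) (by linarith)
  -- Above `N` vertices, half of the exponent absorbs the factor `M`; up to `N`, `ρ` is a uniform
  -- lower bound for the probability of oscillation.
  obtain ⟨N, hN⟩ := exists_nat_gt (max 1 (2 * Real.log M / ε))
  have hN1 : (1 : ℝ) < N := (le_max_left _ _).trans_lt hN
  have hN2 : 2 * Real.log M / ε < N := (le_max_right _ _).trans_lt hN
  set ρ := (1 / (N : ℝ)) ^ (⌊2 * C₀ * N⌋₊ + 1) with hρ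
  have hρ0 : 0 < ρ := by positivity
  refine ⟨min (ε / 2) (ρ / (2 * N)), by positivity, ?_⟩
  intro V _ G _ Ω _ μ _ X hV hX
  classical
  have hV3 : (3 : ℝ) ≤ Fintype.card V := by exact_mod_cast hV
  set n := (Fintype.card V : ℝ) with hn
  -- `visits` counts times strictly before `t`, hence the `+ 1`; the doubled constant `2 * C₀` makes
  -- room for it.
  set t := ⌊C₀ * n⌋₊ + 1 with ht
  have htn : (t : ℝ) ≤ 2 * C₀ * n := by
    have := Nat.floor_le (by positivity : 0 ≤ C₀ * n)
    rw [ht]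
    push_cast
    nlinarith
  have hsub : {ω | (fun t : ℕ => X t ω) '' {t : ℕ | (t : ℝ) ≤ C * n} = Set.univ} ⊆
      {ω | ∀ v, visits (fun i => X i ω) t v ≠ 0} := by
    intro ω hω v
    have hω' : (fun t : ℕ => X t ω) '' {t : ℕ | (t : ℝ) ≤ C * n} = Set.univ := hω
    have hv : v ∈ (fun t : ℕ => X t ω) '' {t : ℕ | (t : ℝ) ≤ C * n} := hω' ▸ Set.mem_univ v
    obtain ⟨i, hi, hiv⟩ := hv
    refine visits_ne_zero_iff.2 ⟨i, Nat.lt_succ_of_le (Nat.le_floor ?_), hiv⟩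
    have hi' : (i : ℝ) ≤ C * n := hi
    have : C * n ≤ C₀ * n := by gcongr; exact le_max_left _ _
    linarith
  refine (measureReal_mono hsub).trans_lt ?_
  rcases lt_or_ge (N : ℝ) n with hNn | hNn
  · refine (key G hX t htn).trans_lt ?_
    rw [← Real.exp_log hM, ← Real.exp_add]
    refine Real.exp_lt_exp.2 ?_
    rw [div_lt_iff₀ hε] at hN2
    have h1 : min (ε / 2) (ρ / (2 * N)) * n ≤ ε / 2 * n := by gcongr; exact min_le_left _ _
    have h2 := mul_lt_mul_of_pos_right hNn hε
    linarith
  · refine (hX.cover_le_one_sub hV t).trans_lt ?_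
    have h1 : ρ ≤ (1 / n) ^ (t + 1) := by
      have h2 : t ≤ ⌊2 * C₀ * N⌋₊ := Nat.le_floor (htn.trans (by gcongr))
      have h3 : 1 / (N : ℝ) ≤ 1 / n := one_div_le_one_div_of_le (by positivity) hNn
      calc ρ ≤ (1 / (N : ℝ)) ^ (t + 1) :=
            pow_le_pow_of_le_one (by positivity) ((div_le_one (by positivity)).2 hN1.le) (by omega)
        _ ≤ _ := pow_le_pow_left₀ (by positivity) h3 _
    have h4 : min (ε / 2) (ρ / (2 * N)) * n ≤ ρ / 2 :=
      calc min (ε / 2) (ρ / (2 * N)) * n ≤ ρ / (2 * N) * N := by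
            gcongr; exact min_le_right _ _
        _ = ρ / 2 := by field_simp
    -- The target is at least `1 - ρ / 2`, strictly above `1 - ρ`.
    have h5 := Real.add_one_le_exp (-min (ε / 2) (ρ / (2 * N)) * n)
    linarith
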